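/- Let $\mathcal O=\mathbb Z[i]$ and $K=\mathbb Q(i)\subset\mathbb C$. Put $\varpi=2\int_0^1\frac{dt}{\sqrt{1-t^4}}$. Let $\varphi:\mathbb R\to\mathbb R$ be the lemniscatic function: on $[-\varpi/2,\varpi/2]$ it is the inverse of $r\mapsto\int_0^r\frac{dt}{\sqrt{1-t^4}}$, $r\in[-1,1]$, and it is extended to $\mathbb R$ by $\varphi(s+\varpi)=-\varphi(s)$, so it has period $2\varpi$. It is extended to $\mathbb C$ by $$\varphi(x+iy)=\frac{\varphi(x)\varphi'(y)+i\,\varphi(y)\varphi'(x)}{1-\varphi(x)^2\varphi(y)^2}\qquad(x,y\in\mathbb R),$$ an elliptic function with period lattice $L=\mathbb Z(1+i)\varpi+\mathbb Z(1-i)\varpi$. Let $\beta\in\mathcal O$ be odd, that is, relatively prime to $1+i$, and let $K_\beta=K(\varphi(\tfrac{2\varpi}{\beta}))\subset\mathbb C$. Call $\delta\in\frac1\beta L$ a $\beta$-torsion generator if its class generates $\frac1\beta L/L$ as an $\mathcal O$-module. Then $K_\beta$ is a Galois extension of $K$ that contains $\varphi(\delta)$ for every $\beta$-torsion generator $\delta$,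 and for every $\sigma\in\mathrm{Gal}(K_\beta/K)$ there is a unique class $[\alpha]\in(\mathcal O/\beta\mathcal O)^\times$ such that $$\sigma(\varphi(\delta))=\varphi(\alpha\delta)\qquad\text{for every $\beta$-torsion generator }\delta$$ (and every representative $\alpha$ of the class). Furthermore, the map $\sigma\mapsto[\alpha]$ is an injective group homomorphism $\mathrm{Gal}(K_\beta/K)\hookrightarrow(\mathcal O/\beta\mathcal O)^\times$. -/

import Mathlib

namespace Lemniscate

/-- Signed arc length of the lemniscate as a function of the radial distance `r`, `|r| ≤ 1`. -/
noncomputable def arcLength (r : ℝ) : ℝ :=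
  ∫ t in (0 : ℝ)..r, 1 / Real.sqrt (1 - t ^ 4)

/-- The lemniscate constant `ϖ`: half of it is the arc length of the first-quadrant portion. -/
noncomputable def varpi : ℝ := 2 * arcLength 1

/-- The inverse function of the arc length, as a map from `[-ϖ/2, ϖ/2]` to `[-1, 1]`. -/
noncomputable def arcInv (s : ℝ) : ℝ :=
  Function.invFunOn arcLength (Set.Icc (-1) 1) s

/-- The real lemniscatic function `φ` (Gauss's lemniscatic sine): it inverts the arc length on
`[-ϖ/2, ϖ/2]` and is continued to `ℝ` by `φ (s + ϖ) = -φ s`, so that it has period `2ϖ`. -/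
noncomputable def phiReal (s : ℝ) : ℝ :=
  (-1) ^ (round (s / varpi) : ℤ) * arcInv (s - (round (s / varpi) : ℤ) * varpi)

/-- The complex lemniscatic function
`φ (x + i y) = (φ x φ' y + i φ y φ' x) / (1 - φ(x)² φ(y)²)`.
The denominator vanishes exactly at the poles `(1 ± i) ϖ / 2 + L`, where the value is not used. -/
noncomputable def phi (z : ℂ) : ℂ :=
  ((phiReal z.re : ℂ) * (deriv phiReal z.im : ℝ)
      + Complex.I * (phiReal z.im : ℂ) * (deriv phiReal z.re : ℝ)) /
    (1 - (phiReal z.re : ℂ) ^ 2 * (phiReal z.im : ℂ) ^ 2)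

/-- The period lattice `L = ℤ (1 + i) ϖ + ℤ (1 - i) ϖ`. -/
noncomputable def lattice : AddSubgroup ℂ :=
  AddSubgroup.closure {(1 + Complex.I) * (varpi : ℂ), (1 - Complex.I) * (varpi : ℂ)}

/-- `β ∈ ℤ[i]` is odd if it is relatively prime to `1 + i`. -/
def IsOdd (β : GaussianInt) : Prop := IsCoprime β (⟨1, 1⟩ : GaussianInt)

/-- For nonzero `β`, `δ` is a `β`-torsion generator: `δ` lies in `(1/β) L`, and its class generates
`(1/β) L / L` as a `ℤ[i]`-module, i.e. every `w ∈ (1/β) L` is congruent mod `L` to some `α δ`. -/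
def IsTorsionGenerator (β : GaussianInt) (δ : ℂ) : Prop :=
  GaussianInt.toComplex β * δ ∈ lattice ∧
    ∀ w : ℂ, GaussianInt.toComplex β * w ∈ lattice →
      ∃ α : GaussianInt, w - GaussianInt.toComplex α * δ ∈ lattice

/-- The field `K = ℚ(i)` inside `ℂ`. -/
noncomputable abbrev K : IntermediateField ℚ ℂ := IntermediateField.adjoin ℚ {Complex.I}

/-- The field `K_β = K(φ(2ϖ/β))` inside `ℂ`. -/
noncomputable abbrev KBeta (β : GaussianInt) : IntermediateField K ℂ :=
  IntermediateField.adjoin K {phi (2 * (varpi : ℂ) / GaussianInt.toComplex β)}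

/-- The quotient ring `ℤ[i] / β ℤ[i]`. -/
abbrev ResidueRing (β : GaussianInt) : Type := GaussianInt ⧸ Ideal.span {β}

/-- `σ (φ δ) = φ (α δ)` for every `β`-torsion generator `δ` and every representative `α` of the
class `u`; that `φ δ` lies in `K_β`, so that `σ` applies to it, is part of the assertion. -/
def ActsThrough (β : GaussianInt) (σ : KBeta β ≃ₐ[K] KBeta β) (u : (ResidueRing β)ˣ) : Prop :=
  ∀ δ : ℂ, IsTorsionGenerator β δ →
    ∃ hδ : phi δ ∈ KBeta β,
      ∀ α : GaussianInt, Ideal.Quotient.mk (Ideal.span {β}) α = (u : ResidueRing β) →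
        ((σ ⟨phi δ, hδ⟩ : KBeta β) : ℂ) = phi (GaussianInt.toComplex α * δ)

end Lemniscate

/-! The quartic `y² = 1 - x⁴`, parametrized by `(φ, φ')`, is birational to the elliptic curve `v² =
u³ + 4u`, which has complex multiplication by `ℤ[i]` through `(u, v) ↦ (-u, iv)`. The addition
theorem for `φ` is the group law of this curve (`quarticPoint_add`), so `uniformization` is a
homomorphism from `ℂ` to the complex points with kernel `L` that commutes with `i`. On points of odd
order, `φ(z)` is the value of the rational function `2u/v` (`phi_eq_quarticX`), and this function is
injective there (`eq_of_quarticX_eq`).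

Since `1 + i` is invertible modulo `β`, the class of `2ϖ/β` generates the `β`-torsion over `ℤ[i]`,
with annihilator `β`. Torsion points have algebraic coordinates, because there are only finitely
many of each odd order (`isAlgebraic_of_torsion`). An embedding over `K` fixes `i`, so it respects
both the group law and the multiplication by `ℤ[i]`. It therefore sends the point of `2ϖ/β` to some
multiple by `α`, and then acts on every torsion value by `φ(δ) ↦ φ(αδ)`
(`exists_gaussian_of_algHom`).

The rest follows formally. An automorphism fixing `φ(2ϖ/β)` has `α ≡ 1`, so all torsion values lie
in `K_β`. The conjugates of `φ(2ϖ/β)` are torsion values, so `K_β` is Galois. The class of `α` is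
multiplicative in `σ` and determines `σ` on the generator. -/

namespace Lemniscate

/-! ### The real lemniscatic function: differential equation, zeros, addition formulas. -/

open Real Set

/-- The arc length of the lemniscate in terms of the angle `θ` with `r = sin θ`. -/
noncomputable def angleLength (θ : ℝ) : ℝ := ∫ t in (0 : ℝ)..θ, 1 / √(1 + sin t ^ 2)

lemma one_add_sin_sq_pos (t : ℝ) : 0 < 1 + sin t ^ 2 := by positivity

lemma continuous_angleDensity : Continuous fun t : ℝ => 1 / √(1 + sin t ^ 2) := by
  refine continuous_const.div (by fun_prop) fun t => ?_
  exact (sqrt_pos.2 (one_add_sin_sq_pos t)).ne'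

lemma hasDerivAt_angleLength (θ : ℝ) :
    HasDerivAt angleLength (1 / √(1 + sin θ ^ 2)) θ :=
  intervalIntegral.integral_hasDerivAt_right (continuous_angleDensity.intervalIntegrable _ _)
    (continuous_angleDensity.stronglyMeasurableAtFilter _ _) continuous_angleDensity.continuousAt

lemma continuous_angleLength : Continuous angleLength :=
  continuous_iff_continuousAt.2 fun θ => (hasDerivAt_angleLength θ).continuousAt

lemma strictMono_angleLength : StrictMono angleLength :=
  strictMono_of_deriv_pos fun θ => by
    rw [(hasDerivAt_angleLength θ).deriv]
    have := one_add_sin_sq_pos θ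
    positivity

lemma angleLength_zero : angleLength 0 = 0 := by simp [angleLength]

lemma angleLength_neg (θ : ℝ) : angleLength (-θ) = -angleLength θ := by
  have := intervalIntegral.integral_comp_neg (a := 0) (b := θ) fun t : ℝ => 1 / √(1 + sin t ^ 2)
  simp only [sin_neg, neg_sq, neg_zero] at this
  rw [angleLength, angleLength, this, intervalIntegral.integral_symm]

/-- Substitute `t = sin θ`: since `1 - sin⁴ = cos² (1 + sin²)`, the Jacobian cancels the endpoint
singularity and leaves a smooth density on all of `ℝ`. -/
lemma arcLength_sin {θ : ℝ} (h : θ ∈ Icc (-(π / 2)) (π / 2)) :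
    arcLength (sin θ) = angleLength θ := by
  have hmem : ∀ x ∈ Ioo (min 0 θ) (max 0 θ), 0 < cos x := fun x hx => by
    refine cos_pos_of_mem_Ioo ⟨?_, ?_⟩
    · exact (le_min (by linarith [pi_pos]) h.1).trans_lt hx.1
    · exact hx.2.trans_le (max_le (by linarith [pi_pos]) h.2)
  have key := intervalIntegral.integral_comp_mul_deriv_of_deriv_nonneg (a := 0) (b := θ)
    (f := sin) (f' := cos) (g := fun t : ℝ => 1 / √(1 - t ^ 4)) continuous_sin.continuousOn
    (fun x _ => hasDerivAt_sin x) (fun x hx => (hmem x hx).le)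
  rw [sin_zero] at key
  rw [arcLength, ← key, angleLength]
  refine intervalIntegral.integral_congr_ae ?_
  -- The cosine may vanish at the right end of the interval, a null set.
  have hne : ∀ᵐ x : ℝ, x ≠ max 0 θ := by
    simp [Filter.Eventually, MeasureTheory.mem_ae_iff]
  filter_upwards [hne] with x hx hx'
  have hc : 0 < cos x := hmem x ⟨hx'.1, lt_of_le_of_ne hx'.2 hx⟩
  have h4 : 1 - sin x ^ 4 = cos x ^ 2 * (1 + sin x ^ 2) := by
    rw [cos_sq']; ring
  simp only [Function.comp, h4]
  rw [sqrt_mul (sq_nonneg _), sqrt_sq hc.le]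
  have := sqrt_pos.2 (one_add_sin_sq_pos x)
  field_simp

lemma angleLength_pi_div_two : angleLength (π / 2) = varpi / 2 := by
  rw [← arcLength_sin ⟨by linarith [pi_pos], le_rfl⟩, sin_pi_div_two, varpi]
  ring

lemma varpi_pos : 0 < varpi := by
  have := strictMono_angleLength (half_pos pi_pos)
  rw [angleLength_zero, angleLength_pi_div_two] at this
  linarith

/-- The density has period `π`, so the increment is constant; it is evaluated at `-π/2`. -/
lemma angleLength_add_pi (θ : ℝ) : angleLength (θ + π) = angleLength θ + varpi := by
  have hd : ∀ x, HasDerivAt (fun x => angleLength (x + π) - angleLength x) 0 x := fun x => by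
    have := ((hasDerivAt_angleLength (x + π)).comp_add_const x π).sub (hasDerivAt_angleLength x)
    exact this.congr_deriv (by simp)
  have hc := is_const_of_deriv_eq_zero (fun x => (hd x).differentiableAt) (fun x => (hd x).deriv)
    θ (-(π / 2))
  have h2 : -(π / 2) + π = π / 2 := by ring
  simp only [h2, angleLength_neg, angleLength_pi_div_two] at hc
  linarith

lemma angleLength_add_int_mul_pi (θ : ℝ) (k : ℤ) :
    angleLength (θ + k * π) = angleLength θ + k * varpi := by
  induction k with
  | zero => simp
  | succ k ih =>
    have h := angleLength_add_pi (θ + k * π)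
    have e : θ + ((k : ℤ) + 1 : ℤ) * π = θ + k * π + π := by push_cast; ring
    rw [e, h]
    push_cast at ih ⊢
    rw [ih]; ring
  | pred k ih =>
    have h := angleLength_add_pi (θ + ((-(k : ℤ) - 1 : ℤ) : ℝ) * π)
    have e : θ + ((-(k : ℤ) - 1 : ℤ) : ℝ) * π + π = θ + ((-(k : ℤ) : ℤ) : ℝ) * π := by
      push_cast; ring
    rw [e, ih] at h
    push_cast at h ⊢
    linarith

lemma surjective_angleLength : Function.Surjective angleLength := by
  intro s
  obtain ⟨n, hn⟩ := exists_nat_gt (|s| / varpi)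
  have hs : |s| < n * varpi := (div_lt_iff₀ varpi_pos).1 hn
  have h1 := angleLength_add_int_mul_pi 0 n
  have h2 := angleLength_add_int_mul_pi 0 (-n)
  simp only [angleLength_zero, zero_add] at h1 h2
  obtain ⟨θ, -, h⟩ := intermediate_value_uIcc (a := ((-n : ℤ) : ℝ) * π) (b := ((n : ℤ) : ℝ) * π)
    continuous_angleLength.continuousOn (show s ∈ _ by
      rw [h1, h2, uIcc_of_le (by push_cast; nlinarith [varpi_pos, abs_nonneg s])]
      push_cast
      constructor <;> cases abs_lt.1 hs <;> linarith)
  exact ⟨θ, h⟩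

/-- The angle `θ` whose arc length is `s`. -/
noncomputable def amplitude : ℝ ≃o ℝ :=
  (strictMono_angleLength.orderIsoOfSurjective _ surjective_angleLength).symm

lemma angleLength_amplitude (s : ℝ) : angleLength (amplitude s) = s :=
  (strictMono_angleLength.orderIsoOfSurjective _ surjective_angleLength).apply_symm_apply s

lemma amplitude_angleLength (θ : ℝ) : amplitude (angleLength θ) = θ :=
  (strictMono_angleLength.orderIsoOfSurjective _ surjective_angleLength).symm_apply_apply θ

lemma hasDerivAt_amplitude (s : ℝ) :
    HasDerivAt amplitude (√(1 + sin (amplitude s) ^ 2)) s := by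
  have h := HasDerivAt.of_local_left_inverse (f := angleLength) (g := amplitude)
    amplitude.continuous.continuousAt (hasDerivAt_angleLength (amplitude s))
    (by have := one_add_sin_sq_pos (amplitude s); positivity)
    (Filter.Eventually.of_forall angleLength_amplitude)
  simpa using h

lemma amplitude_add_int_mul_varpi (s : ℝ) (k : ℤ) :
    amplitude (s + k * varpi) = amplitude s + k * π := by
  rw [← amplitude_angleLength (amplitude s + k * π), angleLength_add_int_mul_pi,
    angleLength_amplitude]

lemma amplitude_zero : amplitude 0 = 0 := by
  simpa [angleLength_zero] using amplitude_angleLength 0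

lemma arcInv_eq_sin_amplitude {s : ℝ} (h : |s| ≤ varpi / 2) : arcInv s = sin (amplitude s) := by
  have hmem : amplitude s ∈ Icc (-(π / 2)) (π / 2) := by
    rw [abs_le] at h
    constructor <;> rw [← strictMono_angleLength.le_iff_le, angleLength_amplitude]
    · rw [angleLength_neg, angleLength_pi_div_two]; exact h.1
    · rw [angleLength_pi_div_two]; exact h.2
  have hs : arcLength (sin (amplitude s)) = s := by
    rw [arcLength_sin hmem, angleLength_amplitude]
  have hinj : InjOn arcLength (Icc (-1) 1) := by
    intro a ha b hb hab
    rw [← sin_arcsin ha.1 ha.2, ← sin_arcsin hb.1 hb.2] at hab ⊢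
    rw [arcLength_sin (arcsin_mem_Icc a), arcLength_sin (arcsin_mem_Icc b)] at hab
    rw [strictMono_angleLength.injective hab]
  have hex : ∃ r ∈ Icc (-1 : ℝ) 1, arcLength r = s :=
    ⟨_, sin_mem_Icc _, hs⟩
  exact hinj (Function.invFunOn_mem hex) (sin_mem_Icc _) ((Function.invFunOn_eq hex).trans hs.symm)

/-- A shift of the arc by `kϖ` is a shift of the angle by `kπ`, which accounts for the sign
`(-1)^k`. The piecewise definition thus becomes one globally differentiable formula. -/
lemma phiReal_eq_sin_amplitude (s : ℝ) : phiReal s = sin (amplitude s) := by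
  have hv := varpi_pos
  set k := round (s / varpi) with hk
  have h1 : |s - k * varpi| ≤ varpi / 2 := by
    have h := abs_sub_round (s / varpi)
    have e : s - k * varpi = (s / varpi - round (s / varpi)) * varpi := by
      rw [sub_mul, div_mul_cancel₀ _ hv.ne', hk]
    rw [e, abs_mul, abs_of_pos hv]
    nlinarith
  have h2 : amplitude s = amplitude (s - k * varpi) + k * π := by
    rw [← amplitude_add_int_mul_varpi]; ring_nf
  rw [phiReal, ← hk, arcInv_eq_sin_amplitude h1, h2, sin_add_int_mul_pi]

/-- The derivative of the real lemniscatic function. -/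
noncomputable def phiDeriv (s : ℝ) : ℝ := cos (amplitude s) * √(1 + sin (amplitude s) ^ 2)

lemma hasDerivAt_phiReal (s : ℝ) : HasDerivAt phiReal (phiDeriv s) s := by
  rw [funext phiReal_eq_sin_amplitude]
  exact (hasDerivAt_amplitude s).sin

lemma deriv_phiReal (s : ℝ) : deriv phiReal s = phiDeriv s := (hasDerivAt_phiReal s).deriv

lemma phiDeriv_sq (s : ℝ) : phiDeriv s ^ 2 = 1 - phiReal s ^ 4 := by
  rw [phiDeriv, phiReal_eq_sin_amplitude, mul_pow, sq_sqrt (one_add_sin_sq_pos _).le, cos_sq']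
  ring

lemma hasDerivAt_phiDeriv (s : ℝ) : HasDerivAt phiDeriv (-2 * phiReal s ^ 3) s := by
  have hp := one_add_sin_sq_pos (amplitude s)
  have h1 := (hasDerivAt_amplitude s).cos
  have h2 := ((((hasDerivAt_amplitude s).sin).pow 2).const_add 1).sqrt hp.ne'
  have h := h1.mul h2
  refine h.congr_deriv ?_
  rw [phiReal_eq_sin_amplitude]
  have hq := sqrt_pos.2 hp
  have hs := sq_sqrt hp.le
  simp only [Pi.pow_apply]
  set c := cos (amplitude s)
  set q := √(1 + sin (amplitude s) ^ 2)
  have hc : c ^ 2 = 1 - sin (amplitude s) ^ 2 := cos_sq' _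
  push_cast
  field_simp
  rw [hs, hc]
  ring

lemma phiReal_zero : phiReal 0 = 0 := by
  rw [phiReal_eq_sin_amplitude, amplitude_zero, sin_zero]

lemma phiDeriv_zero : phiDeriv 0 = 1 := by
  simp [phiDeriv, amplitude_zero]

lemma phiReal_int_mul_varpi (k : ℤ) : phiReal (k * varpi) = 0 := by
  have := amplitude_add_int_mul_varpi 0 k
  simp only [zero_add, amplitude_zero] at this
  rw [phiReal_eq_sin_amplitude, this, sin_int_mul_pi]

lemma phiDeriv_varpi : phiDeriv varpi = -1 := by
  have := amplitude_add_int_mul_varpi 0 1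
  simp only [zero_add, amplitude_zero, Int.cast_one, one_mul] at this
  simp [phiDeriv, this]

lemma phiReal_eq_zero_iff {s : ℝ} : phiReal s = 0 ↔ ∃ k : ℤ, s = k * varpi := by
  constructor
  · intro h
    rw [phiReal_eq_sin_amplitude, sin_eq_zero_iff] at h
    obtain ⟨k, hk⟩ := h
    refine ⟨k, ?_⟩
    rw [← angleLength_amplitude s, ← hk]
    simpa [angleLength_zero] using angleLength_add_int_mul_pi 0 k
  · rintro ⟨k, rfl⟩
    exact phiReal_int_mul_varpi k

/-- The arc covers every real point of the quartic: `(b/√(1 + a²), a)` lies on the unit circle, and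
its argument is the required angle. -/
lemma exists_phiReal_eq_phiDeriv_eq {a b : ℝ} (h : b ^ 2 = 1 - a ^ 4) :
    ∃ s, phiReal s = a ∧ phiDeriv s = b := by
  have hp : 0 < 1 + a ^ 2 := by positivity
  have hq := sqrt_pos.2 hp
  have hs := sq_sqrt hp.le
  have hc : (b / √(1 + a ^ 2)) ^ 2 = 1 - a ^ 2 := by
    rw [div_pow, hs, h]; field_simp; ring
  obtain ⟨θ, h1, h2⟩ : ∃ θ : ℝ, cos θ = b / √(1 + a ^ 2) ∧ sin θ = a := by
    have hn : ‖(⟨b / √(1 + a ^ 2), a⟩ : ℂ)‖ = 1 := by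
      rw [Complex.norm_def, Complex.normSq_mk, ← sq, ← sq, hc]; simp
    have hz : (⟨b / √(1 + a ^ 2), a⟩ : ℂ) ≠ 0 := by
      intro h0; rw [h0] at hn; simp at hn
    exact ⟨Complex.arg ⟨b / √(1 + a ^ 2), a⟩, by rw [Complex.cos_arg hz, hn]; simp,
      by rw [Complex.sin_arg, hn]; simp⟩
  refine ⟨angleLength θ, ?_, ?_⟩
  · rw [phiReal_eq_sin_amplitude, amplitude_angleLength, h2]
  · rw [phiDeriv, amplitude_angleLength, h1, h2]; field_simp

/-- With `s + t` held fixed, the right side is constant in its first argument, by `φ'² = 1 - φ⁴` and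
`φ'' = -2φ³`. At `0` it equals `φ(s + t)`. -/
lemma phiReal_add (s t : ℝ) :
    phiReal (s + t) = (phiReal s * phiDeriv t + phiReal t * phiDeriv s) /
      (1 + phiReal s ^ 2 * phiReal t ^ 2) := by
  let F : ℝ → ℝ := fun x => (phiReal x * phiDeriv (s + t - x) + phiReal (s + t - x) * phiDeriv x) /
      (1 + phiReal x ^ 2 * phiReal (s + t - x) ^ 2)
  have hd : ∀ x, HasDerivAt F 0 x := by
    intro x
    have hf := hasDerivAt_phiReal x
    have hg := hasDerivAt_phiDeriv x
    have hf' := (hasDerivAt_phiReal (s + t - x)).comp_const_sub (s + t) x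
    have hg' := (hasDerivAt_phiDeriv (s + t - x)).comp_const_sub (s + t) x
    have hpos : 0 < 1 + phiReal x ^ 2 * phiReal (s + t - x) ^ 2 := by positivity
    refine (((hf.mul hg').add (hf'.mul hg)).div (((hf.pow 2).mul (hf'.pow 2)).const_add 1)
      hpos.ne').congr_deriv ?_
    have e1 := phiDeriv_sq x
    have e2 := phiDeriv_sq (s + t - x)
    rw [div_eq_zero_iff]
    left
    simp only [Pi.pow_apply, Pi.mul_apply, Pi.add_apply]
    push_cast
    generalize phiReal x = a at *
    generalize phiReal (s + t - x) = b at *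
    generalize phiDeriv x = a' at *
    generalize phiDeriv (s + t - x) = b' at *
    linear_combination (-2 * a * b ^ 3) * e1 + (2 * a ^ 3 * b) * e2
  have h := is_const_of_deriv_eq_zero (fun x => (hd x).differentiableAt) (fun x => (hd x).deriv) 0 s
  simpa [F, phiReal_zero, phiDeriv_zero] using h

lemma phiDeriv_add (s t : ℝ) :
    phiDeriv (s + t) = (phiDeriv s * phiDeriv t * (1 - phiReal s ^ 2 * phiReal t ^ 2)
        - 2 * phiReal s * phiReal t * (phiReal s ^ 2 + phiReal t ^ 2)) /
      (1 + phiReal s ^ 2 * phiReal t ^ 2) ^ 2 := by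
  have h1 := (hasDerivAt_phiReal (s + t)).comp_add_const s t
  rw [funext fun x => phiReal_add x t] at h1
  have hf := hasDerivAt_phiReal s
  have hg := hasDerivAt_phiDeriv s
  have hpos : 0 < 1 + phiReal s ^ 2 * phiReal t ^ 2 := by positivity
  have h2 := ((hf.mul_const (phiDeriv t)).add (hg.const_mul (phiReal t))).div
    (((hf.pow 2).mul_const (phiReal t ^ 2)).const_add 1) hpos.ne'
  rw [h1.unique h2]
  congr 1
  have e1 := phiDeriv_sq s
  simp only [Pi.pow_apply, Pi.add_apply]
  push_cast
  linear_combination (-2 * phiReal s * phiReal t ^ 3) * e1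

end Lemniscate

namespace Lemniscate

/-! ### The Weierstrass model and its explicit group law. -/

section Curve

open WeierstrassCurve WeierstrassCurve.Affine

/-- The elliptic curve `v² = u³ + 4u`, which is birational to `y² = 1 - x⁴`
through `x = 2u/v`, `y = (u² - 4)/(u² + 4)`. -/
def curve : WeierstrassCurve ℤ := ⟨0, 0, 0, 4, 0⟩

variable {F : Type*} [Field F]

/-- The group of points of `v² = u³ + 4u` over a field. -/
abbrev CurvePoint (F : Type*) [Field F] : Type _ := (curve⁄F).Point

lemma curve_coeffs : (curve⁄F).a₁ = 0 ∧ (curve⁄F).a₂ = 0 ∧ (curve⁄F).a₃ = 0 ∧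
    (curve⁄F).a₄ = 4 ∧ (curve⁄F).a₆ = 0 := by
  simp [curve, WeierstrassCurve.baseChange, WeierstrassCurve.map]

lemma curve_nonsingular_iff [CharZero F] {u v : F} :
    (curve⁄F).Nonsingular u v ↔ v ^ 2 = u ^ 3 + 4 * u := by
  obtain ⟨h1, h2, h3, h4, h6⟩ := curve_coeffs (F := F)
  rw [nonsingular_iff, equation_iff, h1, h2, h3, h4, h6]
  have e : v ^ 2 + 0 * u * v + 0 * v = u ^ 3 + 0 * u ^ 2 + 4 * u + 0 ↔ v ^ 2 = u ^ 3 + 4 * u := by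
    ring_nf
  rw [e]
  refine ⟨fun h => h.1, fun h => ⟨h, ?_⟩⟩
  by_contra! hc
  obtain ⟨hc1, hc2⟩ := hc
  have hv : v = 0 := by
    have : 2 * v = 0 := by linear_combination hc2
    simpa using this
  have hu : 3 * u ^ 2 + 4 = 0 := by linear_combination -hc1
  have hu' : u * (u ^ 2 + 4) = 0 := by rw [hv] at h; linear_combination -h
  -- A Bézout combination of `u³ + 4u` and its derivative `3u² + 4` equals the constant `64`.
  have h32 : (64 : F) = 0 := by
    linear_combination (16 + 6 * u ^ 2) * hu - (18 * u) * hu'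
  norm_num at h32

/-- The affine point with coordinates `u`, `v`. -/
def mkPoint [CharZero F] (u v : F) (h : v ^ 2 = u ^ 3 + 4 * u) : CurvePoint F :=
  .some u v (curve_nonsingular_iff.2 h)

lemma mkPoint_congr [CharZero F] {u v u' v' : F} (h : v ^ 2 = u ^ 3 + 4 * u) (h' : v' ^ 2 = u' ^ 3 + 4 * u')
    (hu : u = u') (hv : v = v') : mkPoint u v h = mkPoint u' v' h' := by
  subst hu hv; rfl

lemma mkPoint_ne_zero [CharZero F] {u v : F} (h : v ^ 2 = u ^ 3 + 4 * u) : mkPoint u v h ≠ 0 :=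
  Point.some_ne_zero _

lemma eq_zero_or_eq_mkPoint [CharZero F] (P : CurvePoint F) : P = 0 ∨ ∃ u v h, P = mkPoint u v h := by
  rcases P with _ | ⟨u, v, h⟩
  · exact .inl rfl
  · exact .inr ⟨u, v, curve_nonsingular_iff.1 h, rfl⟩

lemma curve_negY (u v : F) : (curve⁄F).negY u v = -v := by
  obtain ⟨h1, h2, h3, h4, h6⟩ := curve_coeffs (F := F)
  rw [Affine.negY, h1, h3]; ring

lemma neg_mkPoint [CharZero F] {u v : F} (h : v ^ 2 = u ^ 3 + 4 * u) :
    -mkPoint u v h = mkPoint u (-v) (by rw [neg_sq, h]) := by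
  rw [mkPoint, Point.neg_some, mkPoint]
  simp only [curve_negY]

/-- The slope enters through an equation without division, so that the sum can be certified by
polynomial identities. -/
lemma mkPoint_add_mkPoint [CharZero F] [DecidableEq F] {u₁ v₁ u₂ v₂ u₃ v₃ : F} (h₁ : v₁ ^ 2 = u₁ ^ 3 + 4 * u₁)
    (h₂ : v₂ ^ 2 = u₂ ^ 3 + 4 * u₂) (h₃ : v₃ ^ 2 = u₃ ^ 3 + 4 * u₃) (hne : u₁ ≠ u₂) {l : F}
    (hl : l * (u₁ - u₂) = v₁ - v₂) (hu : u₃ = l ^ 2 - u₁ - u₂) (hv : -v₃ = v₁ + l * (u₃ - u₁)) :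
    mkPoint u₁ v₁ h₁ + mkPoint u₂ v₂ h₂ = mkPoint u₃ v₃ h₃ := by
  obtain ⟨c1, c2, c3, c4, c6⟩ := curve_coeffs (F := F)
  have hs : (curve⁄F).slope u₁ u₂ v₁ v₂ = l := by
    rw [slope_of_X_ne hne, ← hl, mul_div_cancel_right₀ _ (sub_ne_zero.2 hne)]
  have hX : (curve⁄F).addX u₁ u₂ l = u₃ := by rw [addX, c1, c2, hu]; ring
  rw [mkPoint, mkPoint, Point.add_of_X_ne hne, mkPoint]
  simp only [hs, hX, addY, negAddY, curve_negY]
  congr 1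
  linear_combination hv

lemma mkPoint_add_self [CharZero F] [DecidableEq F] {u₁ v₁ u₃ v₃ : F} (h₁ : v₁ ^ 2 = u₁ ^ 3 + 4 * u₁)
    (h₃ : v₃ ^ 2 = u₃ ^ 3 + 4 * u₃) (hne : v₁ ≠ 0) {l : F}
    (hl : l * (2 * v₁) = 3 * u₁ ^ 2 + 4) (hu : u₃ = l ^ 2 - u₁ - u₁)
    (hv : -v₃ = v₁ + l * (u₃ - u₁)) :
    mkPoint u₁ v₁ h₁ + mkPoint u₁ v₁ h₁ = mkPoint u₃ v₃ h₃ := by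
  obtain ⟨c1, c2, c3, c4, c6⟩ := curve_coeffs (F := F)
  have hne' : v₁ ≠ (curve⁄F).negY u₁ v₁ := by
    rw [curve_negY]; exact fun h => hne (self_eq_neg.1 h)
  have hs : (curve⁄F).slope u₁ u₁ v₁ v₁ = l := by
    have h2 : (2 : F) * v₁ ≠ 0 := by simpa using hne
    rw [slope_of_Y_ne rfl hne', curve_negY, c1, c2, c4, div_eq_iff (by rwa [sub_neg_eq_add, ← two_mul])]
    linear_combination -hl
  have hX : (curve⁄F).addX u₁ u₁ l = u₃ := by rw [addX, c1, c2, hu]; ring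
  rw [mkPoint, Point.add_self_of_Y_ne hne', mkPoint]
  simp only [hs, hX, addY, negAddY, curve_negY]
  congr 1
  linear_combination hv

/-- The point `(0, 0)` of order two. -/
def twoPoint [CharZero F] : CurvePoint F := mkPoint 0 0 (by ring)

lemma twoPoint_add_twoPoint [CharZero F] [DecidableEq F] : (twoPoint : CurvePoint F) + twoPoint = 0 := by
  have h : -(twoPoint : CurvePoint F) = twoPoint := by
    rw [twoPoint, neg_mkPoint]; exact mkPoint_congr _ _ rfl neg_zero
  nth_rewrite 1 [← h]
  exact neg_add_cancel _

lemma translate_equation {u v : F} (hu : u ≠ 0) (h : v ^ 2 = u ^ 3 + 4 * u) :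
    (-4 * v / u ^ 2) ^ 2 = (4 / u) ^ 3 + 4 * (4 / u) := by
  rw [div_pow, mul_pow, h]; field_simp; ring

lemma mkPoint_add_twoPoint [CharZero F] [DecidableEq F] {u v : F} (h : v ^ 2 = u ^ 3 + 4 * u) (hu : u ≠ 0) :
    mkPoint u v h + twoPoint = mkPoint (4 / u) (-4 * v / u ^ 2) (translate_equation hu h) := by
  refine mkPoint_add_mkPoint _ _ _ hu (l := v / u) (by field_simp; ring) ?_ ?_
  · rw [div_pow, h]; field_simp; ring
  · field_simp; ring

end Curve

/-! ### The quartic model: Euler's addition formula as the group law. -/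

section Quartic

variable {F : Type*} [Field F]
/-- The first coordinate of the third point on a chord, cleared of denominators. -/
lemma chord_X {x₁ y₁ x₂ y₂ : F} (h₁ : y₁ ^ 2 = 1 - x₁ ^ 4) (h₂ : y₂ ^ 2 = 1 - x₂ ^ 4) :
    (x₁ * y₂ + x₂ * y₁) ^ 2 * (2 * ((1 + y₁) * x₂ ^ 3 - (1 + y₂) * x₁ ^ 3) ^ 2
      - ((1 + y₁) * x₂ ^ 2 + (1 + y₂) * x₁ ^ 2) * ((1 + y₁) * x₂ ^ 2 - (1 + y₂) * x₁ ^ 2) ^ 2) =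
    ((1 + x₁ ^ 2 * x₂ ^ 2) ^ 2 + (y₁ * y₂ * (1 - x₁ ^ 2 * x₂ ^ 2)
      - 2 * x₁ * x₂ * (x₁ ^ 2 + x₂ ^ 2))) * x₁ ^ 2 * x₂ ^ 2 *
      ((1 + y₁) * x₂ ^ 2 - (1 + y₂) * x₁ ^ 2) ^ 2 := by
  have h₁3 : y₁ ^ 3 = y₁ * (1 - x₁ ^ 4) := by rw [← h₁]; ring
  have h₂3 : y₂ ^ 3 = y₂ * (1 - x₂ ^ 4) := by rw [← h₂]; ring
  have h₁4 : y₁ ^ 4 = (1 - x₁ ^ 4) ^ 2 := by rw [← h₁]; ring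
  have h₂4 : y₂ ^ 4 = (1 - x₂ ^ 4) ^ 2 := by rw [← h₂]; ring
  have h₁5 : y₁ ^ 5 = y₁ * (1 - x₁ ^ 4) ^ 2 := by rw [← h₁]; ring
  have h₂5 : y₂ ^ 5 = y₂ * (1 - x₂ ^ 4) ^ 2 := by rw [← h₂]; ring
  ring_nf
  simp only [h₁, h₂, h₁3, h₂3, h₁4, h₂4, h₁5, h₂5]
  ring

/-- The second coordinate of the third point on a chord, cleared of denominators. -/
lemma chord_Y {x₁ y₁ x₂ y₂ : F} (h₁ : y₁ ^ 2 = 1 - x₁ ^ 4) (h₂ : y₂ ^ 2 = 1 - x₂ ^ 4) :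
    -(((1 + x₁ ^ 2 * x₂ ^ 2) ^ 2 + (y₁ * y₂ * (1 - x₁ ^ 2 * x₂ ^ 2)
      - 2 * x₁ * x₂ * (x₁ ^ 2 + x₂ ^ 2))) * (1 + x₁ ^ 2 * x₂ ^ 2) * x₁ ^ 3 * x₂ *
      ((1 + y₁) * x₂ ^ 2 - (1 + y₂) * x₁ ^ 2)) = 
   (1 + y₁) * x₂ *  ((1 + y₁) * x₂ ^ 2 - (1 + y₂) * x₁ ^ 2) * (x₁ * y₂ + x₂ * y₁) ^ 3
   + ((1 + y₁) * x₂ ^ 3 - (1 + y₂) * x₁ ^ 3) * (x₁ * y₂ + x₂ * y₁) *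
    (((1 + x₁ ^ 2 * x₂ ^ 2) ^ 2 + (y₁ * y₂ * (1 - x₁ ^ 2 * x₂ ^ 2)
      - 2 * x₁ * x₂ * (x₁ ^ 2 + x₂ ^ 2))) * x₁ ^ 2 - (1 + y₁) * (x₁ * y₂ + x₂ * y₁) ^ 2) := by
  have h₁3 : y₁ ^ 3 = y₁ * (1 - x₁ ^ 4) := by rw [← h₁]; ring
  have h₂3 : y₂ ^ 3 = y₂ * (1 - x₂ ^ 4) := by rw [← h₂]; ring
  have h₁4 : y₁ ^ 4 = (1 - x₁ ^ 4) ^ 2 := by rw [← h₁]; ring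
  have h₂4 : y₂ ^ 4 = (1 - x₂ ^ 4) ^ 2 := by rw [← h₂]; ring
  ring_nf
  simp only [h₁, h₂, h₁3, h₂3, h₁4, h₂4]
  ring

lemma one_add_ne_zero_of_quartic {x y : F} (h : y ^ 2 = 1 - x ^ 4) (hx : x ≠ 0) : 1 + y ≠ 0 := by
  intro h0
  have : x ^ 4 = 0 := by linear_combination (1 - y) * h0 + h
  exact hx (pow_eq_zero_iff (by norm_num) |>.1 this)

lemma weierstrass_of_quartic {x y : F} (h : y ^ 2 = 1 - x ^ 4) (hx : x ≠ 0) :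
    (4 * (1 + y) / x ^ 3) ^ 2 = (2 * (1 + y) / x ^ 2) ^ 3 + 4 * (2 * (1 + y) / x ^ 2) := by
  field_simp
  linear_combination (-8 * (1 + y)) * h

open Classical in
/-- The point of the Weierstrass model that corresponds to the point `(x, y)` of `y² = 1 - x⁴`. -/
noncomputable def quarticPoint [CharZero F] (x y : F) (h : y ^ 2 = 1 - x ^ 4) : CurvePoint F :=
  -- These values continue the generic formula: near `(0, 1)` the point goes to infinity, and near
  -- `(0, -1)` one has `1 + y = x⁴/(1 - y)`, so `u` and `v` tend to `0`.
  if hx : x = 0 then (if y = 1 then 0 else twoPoint) else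
    mkPoint (2 * (1 + y) / x ^ 2) (4 * (1 + y) / x ^ 3) (weierstrass_of_quartic h hx)

lemma quarticPoint_congr [CharZero F] {x y x' y' : F} (h : y ^ 2 = 1 - x ^ 4) (h' : y' ^ 2 = 1 - x' ^ 4)
    (hx : x = x') (hy : y = y') : quarticPoint x y h = quarticPoint x' y' h' := by
  subst hx hy; rfl

lemma quarticPoint_of_ne_zero [CharZero F] {x y : F} (h : y ^ 2 = 1 - x ^ 4) (hx : x ≠ 0) :
    quarticPoint x y h =
      mkPoint (2 * (1 + y) / x ^ 2) (4 * (1 + y) / x ^ 3) (weierstrass_of_quartic h hx) := by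
  rw [quarticPoint, dif_neg hx]

lemma quarticPoint_zero_one [CharZero F] (h : (1 : F) ^ 2 = 1 - 0 ^ 4) : quarticPoint 0 1 h = 0 := by
  rw [quarticPoint, dif_pos rfl, if_pos rfl]

lemma quarticPoint_zero_neg_one [CharZero F] (h : (-1 : F) ^ 2 = 1 - 0 ^ 4) :
    quarticPoint 0 (-1) h = twoPoint := by
  rw [quarticPoint, dif_pos rfl, if_neg]
  intro h
  have : (2 : F) = 0 := by linear_combination -h
  norm_num at this

lemma quarticPoint_neg [CharZero F] [DecidableEq F] {x y : F} (h : y ^ 2 = 1 - x ^ 4) (h' : y ^ 2 = 1 - (-x) ^ 4) :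
    quarticPoint (-x) y h' = -quarticPoint x y h := by
  by_cases hx : x = 0
  · subst hx
    have : y = 1 ∨ y = -1 := by rw [← sq_eq_sq_iff_eq_or_eq_neg, h]; ring
    rcases this with rfl | rfl
    · rw [quarticPoint_zero_one, quarticPoint_congr _ h neg_zero rfl, quarticPoint_zero_one,
        neg_zero]
    · rw [quarticPoint_zero_neg_one, quarticPoint_congr _ h neg_zero rfl,
        quarticPoint_zero_neg_one, eq_neg_iff_add_eq_zero, twoPoint_add_twoPoint]
  · rw [quarticPoint_of_ne_zero _ hx, quarticPoint_of_ne_zero _ (neg_ne_zero.2 hx), neg_mkPoint]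
    apply mkPoint_congr
    · ring
    · rw [Odd.neg_pow (by decide), div_neg]

/-- Translation by `(0, 0)` is `u ↦ 4/u`, and `(1 + y)(1 - y) = x⁴` turns this into a change of both
signs. -/
lemma quarticPoint_add_twoPoint [CharZero F] [DecidableEq F] {x y : F} (h : y ^ 2 = 1 - x ^ 4) (h' : (-y) ^ 2 = 1 - (-x) ^ 4) :
    quarticPoint x y h + twoPoint = quarticPoint (-x) (-y) h' := by
  by_cases hx : x = 0
  · subst hx
    have : y = 1 ∨ y = -1 := by rw [← sq_eq_sq_iff_eq_or_eq_neg, h]; ring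
    have hy : (-y) ^ 2 = 1 - (0 : F) ^ 4 := by rw [neg_sq, h]
    rw [quarticPoint_congr h' hy neg_zero rfl]
    rcases this with rfl | rfl
    · rw [quarticPoint_zero_one, zero_add, quarticPoint_zero_neg_one]
    · rw [quarticPoint_zero_neg_one, twoPoint_add_twoPoint, eq_comm,
        quarticPoint_congr hy (by ring) rfl (neg_neg 1), quarticPoint_zero_one]
  · have hy := one_add_ne_zero_of_quartic h hx
    have hu : 2 * (1 + y) / x ^ 2 ≠ 0 := div_ne_zero (mul_ne_zero two_ne_zero hy) (pow_ne_zero 2 hx)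
    rw [quarticPoint_of_ne_zero _ hx, quarticPoint_of_ne_zero _ (neg_ne_zero.2 hx),
      mkPoint_add_twoPoint _ hu]
    apply mkPoint_congr
    · field_simp
      linear_combination (4 : F) * h
    · field_simp
      linear_combination (-4 : F) * h

lemma quartic_add_equation {x₁ y₁ x₂ y₂ : F} (h₁ : y₁ ^ 2 = 1 - x₁ ^ 4)
    (h₂ : y₂ ^ 2 = 1 - x₂ ^ 4) (hD : 1 + x₁ ^ 2 * x₂ ^ 2 ≠ 0) :
    ((y₁ * y₂ * (1 - x₁ ^ 2 * x₂ ^ 2) - 2 * x₁ * x₂ * (x₁ ^ 2 + x₂ ^ 2)) /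
      (1 + x₁ ^ 2 * x₂ ^ 2) ^ 2) ^ 2 =
    1 - ((x₁ * y₂ + x₂ * y₁) / (1 + x₁ ^ 2 * x₂ ^ 2)) ^ 4 := by
  have h₁3 : y₁ ^ 3 = y₁ * (1 - x₁ ^ 4) := by rw [← h₁]; ring
  have h₂3 : y₂ ^ 3 = y₂ * (1 - x₂ ^ 4) := by rw [← h₂]; ring
  have h₁4 : y₁ ^ 4 = (1 - x₁ ^ 4) ^ 2 := by rw [← h₁]; ring
  have h₂4 : y₂ ^ 4 = (1 - x₂ ^ 4) ^ 2 := by rw [← h₂]; ring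
  field_simp
  ring_nf
  simp only [h₁, h₂, h₁3, h₂3, h₁4, h₂4]
  ring

lemma quarticPoint_add [CharZero F] [DecidableEq F] {x₁ y₁ x₂ y₂ x₃ y₃ : F} (h₁ : y₁ ^ 2 = 1 - x₁ ^ 4)
    (h₂ : y₂ ^ 2 = 1 - x₂ ^ 4) (h₃ : y₃ ^ 2 = 1 - x₃ ^ 4)
    (hD : 1 + x₁ ^ 2 * x₂ ^ 2 ≠ 0)
    (hx : x₃ = (x₁ * y₂ + x₂ * y₁) / (1 + x₁ ^ 2 * x₂ ^ 2))
    (hy : y₃ = (y₁ * y₂ * (1 - x₁ ^ 2 * x₂ ^ 2) - 2 * x₁ * x₂ * (x₁ ^ 2 + x₂ ^ 2)) /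
      (1 + x₁ ^ 2 * x₂ ^ 2) ^ 2) :
    quarticPoint x₁ y₁ h₁ + quarticPoint x₂ y₂ h₂ = quarticPoint x₃ y₃ h₃ := by
  by_cases hx₁ : x₁ = 0
  · subst hx₁
    have hy₁ : y₁ = 1 ∨ y₁ = -1 := by rw [← sq_eq_sq_iff_eq_or_eq_neg, h₁]; ring
    rcases hy₁ with rfl | rfl
    · rw [quarticPoint_zero_one, zero_add]
      exact quarticPoint_congr _ _ (by rw [hx]; simp) (by rw [hy]; simp)
    · rw [quarticPoint_zero_neg_one, add_comm, quarticPoint_add_twoPoint h₂ (by rw [neg_sq, h₂]; ring)]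
      exact quarticPoint_congr _ _ (by rw [hx]; simp) (by rw [hy]; simp)
  by_cases hx₂ : x₂ = 0
  · subst hx₂
    have hy₂ : y₂ = 1 ∨ y₂ = -1 := by rw [← sq_eq_sq_iff_eq_or_eq_neg, h₂]; ring
    rcases hy₂ with rfl | rfl
    · rw [quarticPoint_zero_one, add_zero]
      exact quarticPoint_congr _ _ (by rw [hx]; simp) (by rw [hy]; simp)
    · rw [quarticPoint_zero_neg_one, quarticPoint_add_twoPoint h₁ (by rw [neg_sq, h₁]; ring)]
      exact quarticPoint_congr _ _ (by rw [hx]; simp) (by rw [hy]; simp)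
  -- Here the sum has `x₃ = 0`. This forces `x₂ = ±x₁`, and the sum is `twoPoint` or `0`
  -- respectively.
  by_cases hN : x₁ * y₂ + x₂ * y₁ = 0
  · have hsq : (x₁ ^ 2 - x₂ ^ 2) * (1 + x₁ ^ 2 * x₂ ^ 2) = 0 := by
      linear_combination (x₁ * y₂ - x₂ * y₁) * hN + x₂ ^ 2 * h₁ - x₁ ^ 2 * h₂
    have hsq' : x₂ = x₁ ∨ x₂ = -x₁ := by
      rw [← sq_eq_sq_iff_eq_or_eq_neg]
      linear_combination -((mul_eq_zero.1 hsq).resolve_right hD)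
    rw [hN, zero_div] at hx
    subst hx
    rcases hsq' with rfl | rfl
    · have hy₂ : y₂ = -y₁ := by
        have : x₂ * (y₂ + y₁) = 0 := by linear_combination hN
        linear_combination (mul_eq_zero.1 this).resolve_left hx₁
      subst hy₂
      have h' : (-y₁) ^ 2 = 1 - (-x₂) ^ 4 := by rw [h₂]; ring
      have hy₃ : y₃ = -1 := by
        rw [hy, div_eq_iff (pow_ne_zero 2 hD)]
        linear_combination (-(1 - x₂ ^ 2 * x₂ ^ 2)) * h₁
      subst hy₃
      have hneg := quarticPoint_neg h' (by rw [h']; ring)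
      rw [quarticPoint_congr _ h₂ (neg_neg x₂) rfl, ← quarticPoint_add_twoPoint h₁ h'] at hneg
      rw [hneg, quarticPoint_zero_neg_one, neg_add_rev, add_comm, add_assoc, neg_add_cancel,
        add_zero, neg_eq_iff_add_eq_zero, twoPoint_add_twoPoint]
    · have hy₂ : y₂ = y₁ := by
        have : x₁ * (y₂ - y₁) = 0 := by linear_combination hN
        linear_combination (mul_eq_zero.1 this).resolve_left hx₁
      subst hy₂
      have hy₃ : y₃ = 1 := by
        rw [hy, div_eq_iff (pow_ne_zero 2 hD)]
        linear_combination (1 - x₁ ^ 2 * x₁ ^ 2) * h₁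
      subst hy₃
      rw [quarticPoint_neg h₁, add_neg_cancel, quarticPoint_zero_one]
  have hy₁ := one_add_ne_zero_of_quartic h₁ hx₁
  have hy₂ := one_add_ne_zero_of_quartic h₂ hx₂
  have hx₃ : x₃ ≠ 0 := by rw [hx]; exact div_ne_zero hN hD
  rw [quarticPoint_of_ne_zero _ hx₁, quarticPoint_of_ne_zero _ hx₂, quarticPoint_of_ne_zero _ hx₃]
  -- Equal `u`-coordinates: then `y₂ = y₁` and `x₂ = ±x₁`. The sign `-` is excluded by `hN`, which
  -- leaves doubling, with tangent slope `(2 + y)/x`.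
  by_cases hA : (1 + y₁) * x₂ ^ 2 - (1 + y₂) * x₁ ^ 2 = 0
  · have e₁ : (1 - y₁) * (1 + y₂) = x₁ ^ 2 * x₂ ^ 2 := by
      apply mul_right_cancel₀ (pow_ne_zero 2 hx₁)
      linear_combination (-(1 - y₁)) * hA - x₂ ^ 2 * h₁
    have e₂ : (1 - y₂) * (1 + y₁) = x₁ ^ 2 * x₂ ^ 2 := by
      apply mul_right_cancel₀ (pow_ne_zero 2 hx₂)
      linear_combination (1 - y₂) * hA - x₁ ^ 2 * h₂
    have hyy : y₂ = y₁ := by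
      apply mul_left_cancel₀ (two_ne_zero (α := F))
      linear_combination e₁ - e₂
    subst hyy
    have hxx : x₂ = x₁ ∨ x₂ = -x₁ := by
      rw [← sq_eq_sq_iff_eq_or_eq_neg]
      apply mul_left_cancel₀ hy₁
      linear_combination hA
    rcases hxx with rfl | rfl
    · have hN' : x₂ * y₂ + x₂ * y₂ = 2 * x₂ * y₂ := by ring
      have hy0 : y₂ ≠ 0 := by rintro rfl; exact hN (by ring)
      have hD' : 1 + x₂ ^ 2 * x₂ ^ 2 = 2 - y₂ ^ 2 := by rw [h₁]; ring
      have hM : (2 - y₂ ^ 2) ^ 2 + (y₂ * y₂ * (1 - x₂ ^ 2 * x₂ ^ 2)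
          - 2 * x₂ * x₂ * (x₂ ^ 2 + x₂ ^ 2)) = 2 * y₂ ^ 4 := by
        linear_combination (-y₂ ^ 2 - 4) * h₁
      have hD2 : 2 - y₂ ^ 2 ≠ 0 := hD' ▸ hD
      have h1y : 1 + y₃ = 2 * y₂ ^ 4 / (2 - y₂ ^ 2) ^ 2 := by
        rw [hy, hD', ← hM]; field_simp
      have hu : 2 * (1 + y₃) / x₃ ^ 2 = y₂ ^ 2 / x₂ ^ 2 := by
        rw [h1y, hx, hN', hD']; field_simp
      have hv : 4 * (1 + y₃) / x₃ ^ 3 = y₂ * (2 - y₂ ^ 2) / x₂ ^ 3 := by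
        rw [h1y, hx, hN', hD']; field_simp; ring
      refine mkPoint_add_self _ _
        (div_ne_zero (mul_ne_zero (by norm_num) hy₁) (pow_ne_zero 3 hx₁)) (l := (2 + y₂) / x₂)
        ?_ ?_ ?_
      · field_simp
        linear_combination (-4 : F) * h₁
      · rw [hu]; field_simp; ring
      · rw [hu, hv]; field_simp; ring
    · exact absurd (by ring) hN
  · have hu₃ : 2 * (1 + y₃) / x₃ ^ 2 = 2 * ((1 + x₁ ^ 2 * x₂ ^ 2) ^ 2 +
        (y₁ * y₂ * (1 - x₁ ^ 2 * x₂ ^ 2) - 2 * x₁ * x₂ * (x₁ ^ 2 + x₂ ^ 2))) /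
        (x₁ * y₂ + x₂ * y₁) ^ 2 := by
      rw [hx, hy]; field_simp
    have hv₃ : 4 * (1 + y₃) / x₃ ^ 3 = 4 * ((1 + x₁ ^ 2 * x₂ ^ 2) ^ 2 +
        (y₁ * y₂ * (1 - x₁ ^ 2 * x₂ ^ 2) - 2 * x₁ * x₂ * (x₁ ^ 2 + x₂ ^ 2))) *
        (1 + x₁ ^ 2 * x₂ ^ 2) / (x₁ * y₂ + x₂ * y₁) ^ 3 := by
      rw [hx, hy]; field_simp
    have hX := chord_X h₁ h₂
    have hY := chord_Y h₁ h₂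
    refine mkPoint_add_mkPoint _ _ _ ?_ (l := 2 * ((1 + y₁) * x₂ ^ 3 - (1 + y₂) * x₁ ^ 3) /
      (x₁ * x₂ * ((1 + y₁) * x₂ ^ 2 - (1 + y₂) * x₁ ^ 2))) ?_ ?_ ?_
    · intro h
      rw [div_eq_div_iff (pow_ne_zero 2 hx₁) (pow_ne_zero 2 hx₂)] at h
      apply hA
      apply mul_left_cancel₀ (two_ne_zero (α := F))
      linear_combination h
    · field_simp
      ring
    · rw [hu₃]
      generalize (1 + x₁ ^ 2 * x₂ ^ 2) ^ 2 +
        (y₁ * y₂ * (1 - x₁ ^ 2 * x₂ ^ 2) - 2 * x₁ * x₂ * (x₁ ^ 2 + x₂ ^ 2)) = M at *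
      generalize hAdef : (1 + y₁) * x₂ ^ 2 - (1 + y₂) * x₁ ^ 2 = A at *
      generalize x₁ * y₂ + x₂ * y₁ = N at *
      generalize (1 + y₁) * x₂ ^ 3 - (1 + y₂) * x₁ ^ 3 = B at *
      field_simp
      linear_combination -hX
    · rw [hu₃, hv₃]
      generalize (1 + x₁ ^ 2 * x₂ ^ 2) ^ 2 +
        (y₁ * y₂ * (1 - x₁ ^ 2 * x₂ ^ 2) - 2 * x₁ * x₂ * (x₁ ^ 2 + x₂ ^ 2)) = M at *
      generalize hAdef : (1 + y₁) * x₂ ^ 2 - (1 + y₂) * x₁ ^ 2 = A at *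
      generalize x₁ * y₂ + x₂ * y₁ = N at *
      generalize (1 + y₁) * x₂ ^ 3 - (1 + y₂) * x₁ ^ 3 = B at *
      generalize 1 + x₁ ^ 2 * x₂ ^ 2 = D at *
      field_simp
      linear_combination 4 * hY

end Quartic

end Lemniscate

namespace Lemniscate

/-! ### Complex multiplication, base change of points, and the function `2u/v`. -/

section Maps

open WeierstrassCurve WeierstrassCurve.Affine

variable {F E : Type*} [Field F] [CharZero F] [DecidableEq F] [Field E] [CharZero E] [DecidableEq E]

/-- Presents the chord law as polynomial equations, the form in which additivity of `rotate` is
checked. -/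
lemma exists_mkPoint_add_mkPoint {u₁ v₁ u₂ v₂ : F} (h₁ : v₁ ^ 2 = u₁ ^ 3 + 4 * u₁)
    (h₂ : v₂ ^ 2 = u₂ ^ 3 + 4 * u₂) (hne : u₁ ≠ u₂) :
    ∃ l u₃ v₃, ∃ h₃ : v₃ ^ 2 = u₃ ^ 3 + 4 * u₃,
      mkPoint u₁ v₁ h₁ + mkPoint u₂ v₂ h₂ = mkPoint u₃ v₃ h₃ ∧
      l * (u₁ - u₂) = v₁ - v₂ ∧ u₃ = l ^ 2 - u₁ - u₂ ∧ -v₃ = v₁ + l * (u₃ - u₁) := by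
  have hs := sub_ne_zero.2 hne
  have hl : (v₁ - v₂) / (u₁ - u₂) * (u₁ - u₂) = v₁ - v₂ := div_mul_cancel₀ _ hs
  generalize (v₁ - v₂) / (u₁ - u₂) = l at hl
  have hsum : (v₁ + v₂) * l = u₁ ^ 2 + u₁ * u₂ + u₂ ^ 2 + 4 := by
    apply mul_right_cancel₀ hs
    linear_combination (v₁ + v₂) * hl + h₁ - h₂
  have h₃ : (-(v₁ + l * (l ^ 2 - u₁ - u₂ - u₁))) ^ 2 =
      (l ^ 2 - u₁ - u₂) ^ 3 + 4 * (l ^ 2 - u₁ - u₂) := by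
    have hv : v₂ = v₁ - l * (u₁ - u₂) := by rw [hl]; ring
    rw [hv] at hsum
    linear_combination h₁ + (l ^ 2 - u₁ - u₂ - u₁) * hsum
  exact ⟨l, _, _, h₃, mkPoint_add_mkPoint _ _ _ hne hl rfl (neg_neg _), hl, rfl, neg_neg _⟩

lemma exists_mkPoint_add_self {u v : F} (h : v ^ 2 = u ^ 3 + 4 * u) (hne : v ≠ 0) :
    ∃ l u₃ v₃, ∃ h₃ : v₃ ^ 2 = u₃ ^ 3 + 4 * u₃,
      mkPoint u v h + mkPoint u v h = mkPoint u₃ v₃ h₃ ∧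
      l * (2 * v) = 3 * u ^ 2 + 4 ∧ u₃ = l ^ 2 - u - u ∧ -v₃ = v + l * (u₃ - u) := by
  have hl : (3 * u ^ 2 + 4) / (2 * v) * (2 * v) = 3 * u ^ 2 + 4 :=
    div_mul_cancel₀ _ (mul_ne_zero two_ne_zero hne)
  generalize (3 * u ^ 2 + 4) / (2 * v) = l at hl
  have h₃ : (-(v + l * (l ^ 2 - u - u - u))) ^ 2 =
      (l ^ 2 - u - u) ^ 3 + 4 * (l ^ 2 - u - u) := by
    linear_combination h + (l ^ 2 - u - u - u) * hl
  exact ⟨l, _, _, h₃, mkPoint_add_self _ _ hne hl rfl (neg_neg _), hl, rfl, neg_neg _⟩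

omit [CharZero F] [DecidableEq F] in
lemma rotate_equation {i : F} (hi : i ^ 2 = -1) {u v : F} (h : v ^ 2 = u ^ 3 + 4 * u) :
    (i * v) ^ 2 = (-u) ^ 3 + 4 * (-u) := by
  rw [mul_pow, hi, h]; ring

/-- Complex multiplication by a square root `i` of `-1`: `(u, v) ↦ (-u, i v)`. -/
def rotateFun (i : F) (hi : i ^ 2 = -1) : CurvePoint F → CurvePoint F
  | .zero => 0
  | .some u v h => mkPoint (-u) (i * v) (rotate_equation hi (curve_nonsingular_iff.1 h))

/-- Complex multiplication by `i` as a group homomorphism. -/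
def rotate (i : F) (hi : i ^ 2 = -1) : CurvePoint F →+ CurvePoint F where
  toFun := rotateFun i hi
  map_zero' := rfl
  map_add' := by
    have f0 : rotateFun i hi 0 = 0 := rfl
    have hf : ∀ u v h, rotateFun i hi (mkPoint u v h) =
      mkPoint (-u) (i * v) (rotate_equation hi h) := fun _ _ _ => rfl
    generalize rotateFun i hi = f at f0 hf ⊢
    intro P Q
    rcases eq_zero_or_eq_mkPoint P with rfl | ⟨u₁, v₁, h₁, rfl⟩
    · rw [f0, zero_add, zero_add]
    rcases eq_zero_or_eq_mkPoint Q with rfl | ⟨u₂, v₂, h₂, rfl⟩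
    · rw [f0, add_zero, add_zero]
    by_cases hu : u₁ = u₂
    · subst hu
      have hv : v₂ = v₁ ∨ v₂ = -v₁ := by rw [← sq_eq_sq_iff_eq_or_eq_neg, h₁, h₂]
      have hneg : ∀ h', f (mkPoint u₁ v₁ h₁ + mkPoint u₁ (-v₁) h') =
          f (mkPoint u₁ v₁ h₁) + f (mkPoint u₁ (-v₁) h') := fun h' => by
        have h'' : (-(i * v₁)) ^ 2 = (-u₁) ^ 3 + 4 * (-u₁) := by
          rw [neg_sq, rotate_equation hi h₁]
        rw [← neg_mkPoint h₁, add_neg_cancel, f0, neg_mkPoint, hf, hf, eq_comm,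
          mkPoint_congr _ h'' rfl (mul_neg i v₁), ← neg_mkPoint (rotate_equation hi h₁),
          add_neg_cancel]
      rcases hv with rfl | rfl
      · by_cases hv : v₂ = 0
        · subst hv
          have := hneg (by rw [neg_zero, h₂])
          rwa [mkPoint_congr _ h₁ rfl neg_zero] at this
        · obtain ⟨l, u₃, v₃, h₃, e, hl, hu₃, hv₃⟩ := exists_mkPoint_add_self h₁ hv
          have hi0 : i ≠ 0 := by rintro rfl; simp at hi
          rw [e, hf, hf, eq_comm]
          -- The map `(u, v) ↦ (-u, iv)` multiplies slopes by `i/(-1) = -i`.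
          refine mkPoint_add_self _ _ (mul_ne_zero hi0 hv) (l := -(i * l)) ?_ ?_ ?_
          · linear_combination hl - l * (2 * v₂) * hi
          · linear_combination -hu₃ - l ^ 2 * hi
          · linear_combination i * hv₃
      · exact hneg _
    · obtain ⟨l, u₃, v₃, h₃, e, hl, hu₃, hv₃⟩ := exists_mkPoint_add_mkPoint h₁ h₂ hu
      rw [e, hf, hf, hf, eq_comm]
      refine mkPoint_add_mkPoint _ _ _ (fun h => hu (neg_inj.1 h)) (l := -(i * l)) ?_ ?_ ?_
      · linear_combination i * hl
      · linear_combination -hu₃ - l ^ 2 * hi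
      · linear_combination i * hv₃

lemma rotate_mkPoint {i : F} (hi : i ^ 2 = -1) {u v : F} (h : v ^ 2 = u ^ 3 + 4 * u) :
    rotate i hi (mkPoint u v h) = mkPoint (-u) (i * v) (rotate_equation hi h) := rfl

lemma rotate_rotate {i : F} (hi : i ^ 2 = -1) (P : CurvePoint F) :
    rotate i hi (rotate i hi P) = -P := by
  rcases eq_zero_or_eq_mkPoint P with rfl | ⟨u, v, h, rfl⟩
  · simp
  · rw [rotate_mkPoint, rotate_mkPoint, neg_mkPoint]
    exact mkPoint_congr _ _ (neg_neg u) (by rw [← mul_assoc, ← sq, hi]; ring)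

lemma rotate_quarticPoint {i : F} (hi : i ^ 2 = -1) {x y : F} (h : y ^ 2 = 1 - x ^ 4)
    (h' : y ^ 2 = 1 - (i * x) ^ 4) :
    rotate i hi (quarticPoint x y h) = quarticPoint (i * x) y h' := by
  have hi0 : i ≠ 0 := by rintro rfl; simp at hi
  by_cases hx : x = 0
  · subst hx
    have hy : y = 1 ∨ y = -1 := by rw [← sq_eq_sq_iff_eq_or_eq_neg, h]; ring
    rw [quarticPoint_congr h' h (mul_zero i) rfl]
    rcases hy with rfl | rfl
    · rw [quarticPoint_zero_one, map_zero]
    · rw [quarticPoint_zero_neg_one, twoPoint, rotate_mkPoint]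
      exact mkPoint_congr _ _ neg_zero (mul_zero i)
  · rw [quarticPoint_of_ne_zero h hx, quarticPoint_of_ne_zero h' (mul_ne_zero hi0 hx),
      rotate_mkPoint]
    apply mkPoint_congr
    · rw [mul_pow, hi]; field_simp
    · have h3 : (i * x) ^ 3 = -(i * x ^ 3) := by linear_combination i * x ^ 3 * hi
      rw [h3]
      field_simp
      linear_combination (1 + y) * hi

/-- The action of a Gaussian integer on points by complex multiplication. -/
def gaussMul (i : F) (hi : i ^ 2 = -1) (α : GaussianInt) (P : CurvePoint F) : CurvePoint F :=
  α.re • P + α.im • rotate i hi P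

/-- The map on points induced by a homomorphism of fields. -/
noncomputable def mapPoint (f : F →+* E) : CurvePoint F →+ CurvePoint E :=
  Point.map (W' := curve) f.toIntAlgHom

omit [DecidableEq F] [DecidableEq E] in
lemma mapPoint_equation (f : F →+* E) {u v : F} (h : v ^ 2 = u ^ 3 + 4 * u) :
    f v ^ 2 = f u ^ 3 + 4 * f u := by
  simpa [map_ofNat] using congrArg f h

lemma mapPoint_mkPoint (f : F →+* E) {u v : F} (h : v ^ 2 = u ^ 3 + 4 * u) :
    mapPoint f (mkPoint u v h) = mkPoint (f u) (f v) (mapPoint_equation f h) := rfl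

omit [CharZero F] [CharZero E] in
lemma mapPoint_injective (f : F →+* E) : Function.Injective (mapPoint f) :=
  Point.map_injective _

lemma mapPoint_rotate (f : F →+* E) {i : F} (hi : i ^ 2 = -1) (hi' : f i ^ 2 = -1)
    (P : CurvePoint F) : mapPoint f (rotate i hi P) = rotate (f i) hi' (mapPoint f P) := by
  rcases eq_zero_or_eq_mkPoint P with rfl | ⟨u, v, h, rfl⟩
  · simp
  · rw [rotate_mkPoint, mapPoint_mkPoint, mapPoint_mkPoint, rotate_mkPoint]
    exact mkPoint_congr _ _ (map_neg f u) (map_mul f i v)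

lemma mapPoint_gaussMul (f : F →+* E) {i : F} (hi : i ^ 2 = -1) (hi' : f i ^ 2 = -1)
    (α : GaussianInt) (P : CurvePoint F) :
    mapPoint f (gaussMul i hi α P) = gaussMul (f i) hi' α (mapPoint f P) := by
  simp only [gaussMul, map_add, map_zsmul, mapPoint_rotate f hi hi']

/-- The coordinate `x = 2u/v` of the quartic model; it is `0` at the poles `v = 0`, `u ≠ 0`. -/
def quarticX : CurvePoint F → F
  | .zero => 0
  | .some u v _ => 2 * u / v

omit [CharZero F] [DecidableEq F] in
lemma quarticX_zero : quarticX (0 : CurvePoint F) = 0 := rfl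

omit [DecidableEq F] in
lemma quarticX_mkPoint {u v : F} (h : v ^ 2 = u ^ 3 + 4 * u) :
    quarticX (mkPoint u v h) = 2 * u / v := rfl

lemma mapPoint_quarticX (f : F →+* E) (P : CurvePoint F) :
    quarticX (mapPoint f P) = f (quarticX P) := by
  rcases eq_zero_or_eq_mkPoint P with rfl | ⟨u, v, h, rfl⟩
  · simp [quarticX_zero]
  · rw [mapPoint_mkPoint, quarticX_mkPoint, quarticX_mkPoint, map_div₀, map_mul, map_ofNat]

omit [DecidableEq F] in
lemma quarticX_quarticPoint {x y : F} (h : y ^ 2 = 1 - x ^ 4) :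
    quarticX (quarticPoint x y h) = x := by
  by_cases hx : x = 0
  · subst hx
    have hy : y = 1 ∨ y = -1 := by rw [← sq_eq_sq_iff_eq_or_eq_neg, h]; ring
    rcases hy with rfl | rfl
    · rw [quarticPoint_zero_one, quarticX_zero]
    · rw [quarticPoint_zero_neg_one, twoPoint, quarticX_mkPoint]; simp
  · have := one_add_ne_zero_of_quartic h hx
    rw [quarticPoint_of_ne_zero h hx, quarticX_mkPoint]
    field_simp
    norm_num

lemma two_nsmul_mkPoint_zero {u : F} (h : (0 : F) ^ 2 = u ^ 3 + 4 * u) :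
    (2 : ℕ) • mkPoint u 0 h = 0 := by
  rw [two_nsmul, ← neg_eq_iff_add_eq_zero, neg_mkPoint]
  exact mkPoint_congr _ _ rfl neg_zero

lemma eq_zero_of_odd_nsmul {A : Type*} [AddGroup A] {a : A} {m n : ℕ} (hm : 2 ^ m • a = 0)
    (hn : Odd n) (ha : n • a = 0) : a = 0 := by
  have h1 := addOrderOf_dvd_of_nsmul_eq_zero hm
  have h2 := addOrderOf_dvd_of_nsmul_eq_zero ha
  have hc : Nat.Coprime (2 ^ m) n := (Nat.coprime_two_left.2 hn).pow_left m
  exact AddMonoid.addOrderOf_eq_one_iff.1 (Nat.eq_one_of_dvd_coprimes hc h1 h2)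

/-- The function `2u/v` has degree two, and its fibre through `P` also contains `twoPoint - P`. If
`Q` were that second point, `P + Q` would have order two, which is impossible for odd torsion. -/
lemma eq_of_quarticX_eq {P Q : CurvePoint F} {n : ℕ} (hn : Odd n) (hP : n • P = 0)
    (hQ : n • Q = 0) (h : quarticX P = quarticX Q) : P = Q := by
  have hzero : ∀ R : CurvePoint F, n • R = 0 → quarticX R = 0 → R = 0 := by
    intro R hR hx
    rcases eq_zero_or_eq_mkPoint R with rfl | ⟨u, v, e, rfl⟩
    · rfl
    rw [quarticX_mkPoint, div_eq_zero_iff] at hx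
    -- The value `0` occurs at `(0, 0)` and, by the convention for division by zero, at the poles;
    -- all of these are points of order two.
    have hv : v = 0 := by
      rcases hx with hx | hx
      · have hu : u = 0 := by simpa using hx
        subst hu
        have : v ^ 2 = 0 := by rw [e]; ring
        simpa using this
      · exact hx
    subst hv
    exact eq_zero_of_odd_nsmul (m := 1) (two_nsmul_mkPoint_zero e) hn hR
  by_cases hx : quarticX P = 0
  · rw [hzero P hP hx, hzero Q hQ (h ▸ hx)]
  have hx' : quarticX Q ≠ 0 := h ▸ hx
  rcases eq_zero_or_eq_mkPoint P with rfl | ⟨u₁, v₁, h₁, rfl⟩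
  · exact absurd quarticX_zero hx
  rcases eq_zero_or_eq_mkPoint Q with rfl | ⟨u₂, v₂, h₂, rfl⟩
  · exact absurd quarticX_zero hx'
  rw [quarticX_mkPoint] at hx hx'
  have hu₁ : u₁ ≠ 0 := by rintro rfl; simp at hx
  have hv₁ : v₁ ≠ 0 := by rintro rfl; simp at hx
  have hu₂ : u₂ ≠ 0 := by rintro rfl; simp at hx'
  have hv₂ : v₂ ≠ 0 := by rintro rfl; simp at hx'
  rw [quarticX_mkPoint, quarticX_mkPoint, div_eq_div_iff hv₁ hv₂] at h
  have h' : u₁ * v₂ = u₂ * v₁ := by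
    apply mul_left_cancel₀ (two_ne_zero (α := F))
    linear_combination h
  have hprod : (u₁ - u₂) * (u₁ * u₂ - 4) = 0 := by
    apply mul_left_cancel₀ (mul_ne_zero hu₁ hu₂)
    linear_combination (-u₂ ^ 2) * h₁ + u₁ ^ 2 * h₂ - (u₁ * v₂ + u₂ * v₁) * h'
  rcases mul_eq_zero.1 hprod with hu | hu
  · have hu := sub_eq_zero.1 hu
    subst hu
    exact mkPoint_congr _ _ rfl (mul_left_cancel₀ hu₁ h').symm
  · exfalso
    have hu₂' : u₂ = 4 / u₁ := by field_simp; linear_combination hu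
    have hsum : mkPoint u₁ v₁ h₁ + twoPoint = -mkPoint u₂ v₂ h₂ := by
      rw [mkPoint_add_twoPoint h₁ hu₁, neg_mkPoint]
      refine mkPoint_congr _ _ hu₂'.symm ?_
      rw [hu₂'] at h'
      field_simp at h' ⊢
      linear_combination h'
    have ht : (twoPoint : CurvePoint F) = -mkPoint u₂ v₂ h₂ - mkPoint u₁ v₁ h₁ := by
      rw [← hsum]; abel
    have hn' : n • (twoPoint : CurvePoint F) = 0 := by
      rw [ht, smul_sub, smul_neg, hP, hQ]; simp
    exact mkPoint_ne_zero _ (eq_zero_of_odd_nsmul (m := 1)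
      (by rw [pow_one, two_nsmul, twoPoint_add_twoPoint]) hn hn')

end Maps

end Lemniscate

namespace Lemniscate

/-! ### The uniformization of the complex points and its relation to `φ`. -/

open Complex

lemma phiDeriv_sq_ofReal (s : ℝ) : (phiDeriv s : ℂ) ^ 2 = 1 - (phiReal s : ℂ) ^ 4 := by
  exact_mod_cast congrArg ((↑) : ℝ → ℂ) (phiDeriv_sq s)

/-- The parametrization of the real points by the arc length. -/
noncomputable def realPoint : ℝ →+ CurvePoint ℂ where
  toFun s := quarticPoint (phiReal s : ℂ) (phiDeriv s : ℂ) (phiDeriv_sq_ofReal s)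
  map_zero' := by
    have h : (1 : ℂ) ^ 2 = 1 - 0 ^ 4 := by norm_num
    rw [quarticPoint_congr (phiDeriv_sq_ofReal 0) h (by rw [phiReal_zero, ofReal_zero])
      (by rw [phiDeriv_zero, ofReal_one]), quarticPoint_zero_one]
  map_add' s t := by
    refine (quarticPoint_add (phiDeriv_sq_ofReal s) (phiDeriv_sq_ofReal t) _ ?_ ?_ ?_).symm
    · have : (1 + phiReal s ^ 2 * phiReal t ^ 2 : ℝ) ≠ 0 := by positivity
      exact_mod_cast this
    · rw [phiReal_add]; push_cast; ring
    · rw [phiDeriv_add]; push_cast; ring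

lemma realPoint_apply (s : ℝ) :
    realPoint s = quarticPoint (phiReal s : ℂ) (phiDeriv s : ℂ) (phiDeriv_sq_ofReal s) := rfl

lemma quarticX_realPoint (s : ℝ) : quarticX (realPoint s) = phiReal s :=
  quarticX_quarticPoint (phiDeriv_sq_ofReal s)

lemma realPoint_varpi : realPoint varpi = twoPoint := by
  have h := phiReal_int_mul_varpi 1
  rw [Int.cast_one, one_mul] at h
  have h' : (-1 : ℂ) ^ 2 = 1 - 0 ^ 4 := by norm_num
  rw [realPoint_apply, quarticPoint_congr (phiDeriv_sq_ofReal varpi) h' (by rw [h, ofReal_zero])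
    (by rw [phiDeriv_varpi, ofReal_neg, ofReal_one]), quarticPoint_zero_neg_one]

lemma realPoint_int_mul_varpi (k : ℤ) : realPoint (k * varpi) = k • twoPoint := by
  rw [← zsmul_eq_mul, map_zsmul, realPoint_varpi]

/-- Multiplication by `i` on the complex points. -/
noncomputable abbrev rotateI : CurvePoint ℂ →+ CurvePoint ℂ := rotate I I_sq

lemma rotateI_twoPoint : rotateI twoPoint = twoPoint := by
  rw [twoPoint, rotateI, rotate_mkPoint]
  exact mkPoint_congr _ _ neg_zero (mul_zero I)

/-- The uniformization of the complex points of `v² = u³ + 4u`. -/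
noncomputable def uniformization : ℂ →+ CurvePoint ℂ where
  toFun z := realPoint z.re + rotateI (realPoint z.im)
  map_zero' := by simp
  map_add' z w := by simp only [add_re, add_im, map_add]; abel

lemma uniformization_apply (z : ℂ) :
    uniformization z = realPoint z.re + rotateI (realPoint z.im) := rfl

lemma uniformization_I_mul (z : ℂ) : uniformization (I * z) = rotateI (uniformization z) := by
  simp [uniformization_apply, rotate_rotate, add_comm]

lemma uniformization_gauss_mul (α : GaussianInt) (z : ℂ) :
    uniformization (α.toComplex * z) = gaussMul I I_sq α (uniformization z) := by
  have h : α.toComplex * z = α.re • z + α.im • (I * z) := by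
    rw [GaussianInt.toComplex_def, zsmul_eq_mul, zsmul_eq_mul]; ring
  rw [h, map_add, map_zsmul, map_zsmul, uniformization_I_mul, gaussMul]

lemma mem_lattice_iff {z : ℂ} :
    z ∈ lattice ↔ ∃ a b : ℤ, Even (a + b) ∧ z = a * varpi + b * varpi * I := by
  rw [lattice, AddSubgroup.mem_closure_pair]
  constructor
  · rintro ⟨m, n, rfl⟩
    refine ⟨m + n, m - n, ⟨m, by ring⟩, ?_⟩
    simp only [zsmul_eq_mul]
    push_cast
    ring
  · rintro ⟨a, b, ⟨m, hm⟩, rfl⟩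
    refine ⟨m, m - b, ?_⟩
    have ha : (a : ℂ) = 2 * m - b := by
      have : a = 2 * m - b := by omega
      rw [this]; push_cast; ring
    simp only [zsmul_eq_mul]
    rw [ha]
    push_cast
    ring

lemma zsmul_twoPoint_eq_zero_iff {k : ℤ} : k • (twoPoint : CurvePoint ℂ) = 0 ↔ Even k := by
  have h2 : (2 : ℤ) • (twoPoint : CurvePoint ℂ) = 0 := by
    rw [two_zsmul, twoPoint_add_twoPoint]
  rcases Int.even_or_odd' k with ⟨m, rfl | rfl⟩
  · simp [mul_comm, mul_smul, h2]
  · rw [add_smul, mul_comm, mul_smul, h2, smul_zero, zero_add, one_smul]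
    refine iff_of_false (mkPoint_ne_zero _) ?_
    rw [Int.not_even_iff_odd, mul_comm]
    exact odd_two_mul_add_one m

/-- If the image vanishes, comparing `2u/v` equates a real number with a purely imaginary one, so
`φ` vanishes at both coordinates and these are multiples of `ϖ`. Both `ϖ` and `iϖ` map to
`twoPoint`, whence the parity condition. -/
lemma uniformization_eq_zero_iff {z : ℂ} : uniformization z = 0 ↔ z ∈ lattice := by
  have key : ∀ a b : ℤ, realPoint (a * varpi) + rotateI (realPoint (b * varpi)) = 0 ↔
      Even (a + b) := fun a b => by
    rw [realPoint_int_mul_varpi, realPoint_int_mul_varpi, map_zsmul, rotateI_twoPoint, ← add_smul,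
      zsmul_twoPoint_eq_zero_iff]
  rw [mem_lattice_iff, uniformization_apply]
  constructor
  · intro h
    have hX : (phiReal z.re : ℂ) = I * (phiReal (-z.im) : ℂ) := by
      have h' : realPoint z.re = rotateI (realPoint (-z.im)) := by
        rw [map_neg, map_neg, eq_neg_iff_add_eq_zero, h]
      have hq : (phiDeriv (-z.im) : ℂ) ^ 2 = 1 - (I * (phiReal (-z.im) : ℂ)) ^ 4 := by
        rw [mul_pow, I_pow_four, one_mul, phiDeriv_sq_ofReal]
      rw [← quarticX_realPoint, h', rotateI, realPoint_apply, rotate_quarticPoint I_sq _ hq,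
        quarticX_quarticPoint]
    have h1 : phiReal z.re = 0 := by simpa using congrArg re hX
    have h2 : phiReal (-z.im) = 0 := by simpa using (congrArg im hX).symm
    obtain ⟨a, ha⟩ := phiReal_eq_zero_iff.1 h1
    obtain ⟨b, hb⟩ := phiReal_eq_zero_iff.1 h2
    have hb' : z.im = (-b : ℤ) * varpi := by push_cast; linarith
    rw [ha, hb', key] at h
    refine ⟨a, -b, h, ?_⟩
    apply Complex.ext
    · simpa using ha
    · simpa using hb'
  · rintro ⟨a, b, hab, rfl⟩
    have := (key a b).2 hab
    simpa using this

lemma uniformization_eq_iff {z w : ℂ} : uniformization z = uniformization w ↔ z - w ∈ lattice := by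
  rw [← sub_eq_zero, ← map_sub, uniformization_eq_zero_iff]

lemma four_nsmul_realPoint {s : ℝ} (h : phiReal s ^ 2 = 1) : (4 : ℕ) • realPoint s = 0 := by
  have h0 : phiDeriv s = 0 := by
    have := phiDeriv_sq s
    rw [show phiReal s ^ 4 = (phiReal s ^ 2) ^ 2 by ring, h] at this
    simpa using this
  have h2 : realPoint s + realPoint s = twoPoint := by
    rw [← map_add, realPoint_apply, quarticPoint_congr _ (by norm_num) (y' := -1) (x' := 0),
      quarticPoint_zero_neg_one]
    · rw [phiReal_add, h0]; simp
    · rw [phiDeriv_add, h0, show 2 * phiReal s * phiReal s = 2 * phiReal s ^ 2 by ring, h]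
      norm_num
  rw [show (4 : ℕ) = 2 * 2 from rfl, mul_smul, two_nsmul (realPoint s), h2, two_nsmul,
    twoPoint_add_twoPoint]

/-- As `φ² ≤ 1` on the reals, a zero of the denominator has `φ² = 1` at both coordinates, so its
image is killed by `4`. Together with odd order this puts `z` in `L`, where `φ(Re z) = 0`. -/
lemma one_sub_phiReal_ne_zero {z : ℂ} {n : ℕ} (hn : Odd n) (hz : n • uniformization z = 0) :
    1 - phiReal z.re ^ 2 * phiReal z.im ^ 2 ≠ 0 := by
  intro h
  have hle : ∀ s, phiReal s ^ 2 ≤ 1 := fun s => by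
    have := phiDeriv_sq s
    nlinarith [sq_nonneg (phiDeriv s), sq_nonneg (phiReal s)]
  have h1 : phiReal z.re ^ 2 = 1 := by
    nlinarith [hle z.re, hle z.im, sq_nonneg (phiReal z.re), sq_nonneg (phiReal z.im)]
  have h2 : phiReal z.im ^ 2 = 1 := by rw [h1] at h; linarith
  have h4 : (2 ^ 2 : ℕ) • uniformization z = 0 := by
    rw [uniformization_apply, show (2 ^ 2 : ℕ) = 4 from rfl, smul_add, ← map_nsmul rotateI,
      four_nsmul_realPoint h1, four_nsmul_realPoint h2, map_zero, add_zero]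
  have h0 := uniformization_eq_zero_iff.1 (eq_zero_of_odd_nsmul h4 hn hz)
  obtain ⟨a, b, -, rfl⟩ := mem_lattice_iff.1 h0
  have : phiReal (a * varpi) = 0 := phiReal_int_mul_varpi a
  simp [this] at h1

/-- The defining formula of `φ(x + iy)` is the addition formula applied to `(φ(x), φ'(x))` and
`(iφ(y), φ'(y))`. -/
lemma phi_eq_quarticX {z : ℂ} {n : ℕ} (hn : Odd n) (hz : n • uniformization z = 0) :
    phi z = quarticX (uniformization z) := by
  have hD := one_sub_phiReal_ne_zero hn hz
  have hD' : 1 + (phiReal z.re : ℂ) ^ 2 * (I * (phiReal z.im : ℂ)) ^ 2 ≠ 0 := by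
    rw [mul_pow, I_sq]
    intro h
    apply hD
    have : ((1 - phiReal z.re ^ 2 * phiReal z.im ^ 2 : ℝ) : ℂ) = 0 := by
      push_cast; linear_combination h
    exact_mod_cast this
  have hq : (phiDeriv z.im : ℂ) ^ 2 = 1 - (I * (phiReal z.im : ℂ)) ^ 4 := by
    rw [mul_pow, I_pow_four, one_mul, phiDeriv_sq_ofReal]
  have e1 := phiDeriv_sq_ofReal z.re
  rw [uniformization_apply, rotateI, realPoint_apply, realPoint_apply, rotate_quarticPoint I_sq _ hq,
    quarticPoint_add _ _ (x₃ := _) (y₃ := _) ?_ hD' rfl rfl, quarticX_quarticPoint, phi,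
    deriv_phiReal, deriv_phiReal]
  · rw [mul_pow I, I_sq]
    congr 1
    all_goals ring
  · exact quartic_add_equation e1 hq hD'

lemma exists_realPoint_eq {P : CurvePoint ℂ} (h : mapPoint (starRingEnd ℂ) P = P) :
    ∃ s, realPoint s = P := by
  rcases eq_zero_or_eq_mkPoint P with rfl | ⟨u, v, e, rfl⟩
  · exact ⟨0, map_zero _⟩
  have hinj : starRingEnd ℂ u = u ∧ starRingEnd ℂ v = v := by
    rw [mapPoint_mkPoint] at h
    exact WeierstrassCurve.Affine.Point.some.inj h
  obtain ⟨u, rfl⟩ := conj_eq_iff_real.1 hinj.1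
  obtain ⟨v, rfl⟩ := conj_eq_iff_real.1 hinj.2
  have e' : v ^ 2 = u ^ 3 + 4 * u := by exact_mod_cast e
  have hp : u ^ 2 + 4 ≠ 0 := by positivity
  by_cases hu : u = 0
  · subst hu
    have hv : v = 0 := by simpa using e'
    subst hv
    exact ⟨varpi, realPoint_varpi.trans (mkPoint_congr _ _ ofReal_zero.symm ofReal_zero.symm)⟩
  have hv : v ≠ 0 := by
    rintro rfl
    have : u * (u ^ 2 + 4) = 0 := by linear_combination -e'
    exact (mul_ne_zero hu hp) this
  obtain ⟨s, hs1, hs2⟩ := exists_phiReal_eq_phiDeriv_eq (a := 2 * u / v)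
    (b := (u ^ 2 - 4) / (u ^ 2 + 4)) (by
      have h4 : v ^ 4 = (u ^ 3 + 4 * u) ^ 2 := by rw [← e']; ring
      rw [div_pow (2 * u), h4]
      field_simp
      ring)
  refine ⟨s, ?_⟩
  have hx : (phiReal s : ℂ) ≠ 0 := by
    rw [hs1]
    exact_mod_cast div_ne_zero (mul_ne_zero two_ne_zero hu) hv
  have h1 : 2 * (1 + phiDeriv s) / phiReal s ^ 2 = u := by
    rw [hs1, hs2, div_pow, e']; field_simp; ring
  have h2 : 4 * (1 + phiDeriv s) / phiReal s ^ 3 = v := by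
    rw [hs1, hs2, div_pow, pow_succ v, e']; field_simp; ring
  rw [realPoint_apply, quarticPoint_of_ne_zero _ hx]
  exact mkPoint_congr _ _ (by exact_mod_cast congrArg ofReal h1)
    (by exact_mod_cast congrArg ofReal h2)

lemma conj_conj_point (P : CurvePoint ℂ) :
    mapPoint (starRingEnd ℂ) (mapPoint (starRingEnd ℂ) P) = P := by
  rcases eq_zero_or_eq_mkPoint P with rfl | ⟨u, v, e, rfl⟩
  · simp
  · rw [mapPoint_mkPoint, mapPoint_mkPoint]
    exact mkPoint_congr _ _ (conj_conj u) (conj_conj v)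

/-- Conjugation fixes `P + P̄` and also `i(P - P̄)`, since it anticommutes with `i`. Both come from
the real arc, and `2P = (P + P̄) + (P - P̄)`. -/
lemma exists_uniformization_eq_two_nsmul (P : CurvePoint ℂ) :
    ∃ z, uniformization z = (2 : ℕ) • P := by
  set Q := mapPoint (starRingEnd ℂ) P with hQ
  have hQ' : mapPoint (starRingEnd ℂ) Q = P := conj_conj_point P
  obtain ⟨s, hs⟩ := exists_realPoint_eq (P := P + Q) (by rw [map_add, hQ', ← hQ, add_comm])
  have hI : (starRingEnd ℂ) I ^ 2 = -1 := by rw [conj_I, neg_sq, I_sq]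
  have hrot : ∀ R, rotate ((starRingEnd ℂ) I) hI R = -rotateI R := fun R => by
    rcases eq_zero_or_eq_mkPoint R with rfl | ⟨u, v, e, rfl⟩
    · simp
    · rw [rotate_mkPoint, rotateI, rotate_mkPoint, neg_mkPoint]
      exact mkPoint_congr _ _ rfl (by rw [conj_I, neg_mul])
  obtain ⟨t, ht⟩ := exists_realPoint_eq (P := rotateI (P - Q)) (by
    rw [rotateI, mapPoint_rotate _ _ hI, hrot, map_sub, hQ', ← hQ, ← map_neg, neg_sub])
  refine ⟨s + (-t : ℝ) * I, ?_⟩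
  have h1 : ((s : ℂ) + (-t : ℝ) * I).re = s := by simp
  have h2 : ((s : ℂ) + (-t : ℝ) * I).im = -t := by simp
  rw [uniformization_apply, h1, h2, hs, map_neg, ht, map_neg, rotate_rotate, two_nsmul]
  abel

/-- Doubling is invertible on odd torsion: for `n = 2k + 1`, `P = 2(k + 1)P`. -/
lemma exists_uniformization_eq {P : CurvePoint ℂ} {n : ℕ} (hn : Odd n) (hP : n • P = 0) :
    ∃ z, uniformization z = P := by
  obtain ⟨k, rfl⟩ := hn
  obtain ⟨z, hz⟩ := exists_uniformization_eq_two_nsmul P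
  refine ⟨(k + 1 : ℕ) • z, ?_⟩
  rw [map_nsmul, hz, ← mul_smul, show (k + 1) * 2 = (2 * k + 1) + 1 by ring, add_smul, hP]
  simp

end Lemniscate

namespace Lemniscate

/-! ### Odd torsion: the generator `2ϖ/β`, finiteness and algebraicity. -/

open Complex

lemma mul_mem_lattice {α : GaussianInt} {w : ℂ} (hw : w ∈ lattice) :
    α.toComplex * w ∈ lattice := by
  rw [← uniformization_eq_zero_iff] at hw ⊢
  rw [uniformization_gauss_mul, hw]
  simp [gaussMul]

/-- Since `1 - i = -i(1 + i)`, the lattice is the free `ℤ[i]`-module on `(1 + i)ϖ`. -/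
lemma mem_lattice_iff_exists_gaussian {z : ℂ} :
    z ∈ lattice ↔ ∃ c : GaussianInt, z = (1 + I) * varpi * c.toComplex := by
  rw [mem_lattice_iff]
  constructor
  · rintro ⟨a, b, ⟨m, hm⟩, rfl⟩
    refine ⟨⟨m, b - m⟩, ?_⟩
    have ha : (a : ℂ) = 2 * m - b := by
      have : a = 2 * m - b := by omega
      rw [this]; push_cast; ring
    rw [GaussianInt.toComplex_def, ha]
    push_cast
    linear_combination (-(varpi : ℂ) * (b - m)) * I_sq
  · rintro ⟨⟨a, b⟩, rfl⟩
    refine ⟨a - b, a + b, ⟨a, by ring⟩, ?_⟩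
    rw [GaussianInt.toComplex_def]
    push_cast
    linear_combination ((varpi : ℂ) * b) * I_sq

/-- The exponent by which the odd torsion of order `β` is annihilated. -/
abbrev normExponent (β : GaussianInt) : ℕ := β.norm.natAbs

lemma IsOdd.odd_normExponent {β : GaussianInt} (hβ : IsOdd β) : Odd (normExponent β) := by
  obtain ⟨a, b, h⟩ := hβ
  have h1 := congrArg Zsqrtd.re h
  have h2 := congrArg Zsqrtd.im h
  simp only [Zsqrtd.re_add, Zsqrtd.re_mul, Zsqrtd.im_add, Zsqrtd.im_mul, Zsqrtd.re_one,
    Zsqrtd.im_one] at h1 h2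
  have hodd : Odd (β.re + β.im) := by
    rw [← Int.not_even_iff_odd]
    rintro ⟨m, hm⟩
    have hr : β.re = 2 * m - β.im := by omega
    rw [hr] at h1 h2
    -- The sum of the real and imaginary parts of the Bézout relation would be even on one side and
    -- `1` on the other.
    have : (2 : ℤ) ∣ 1 := ⟨a.re * m - a.im * β.im + a.im * m + b.re, by linear_combination -h1 - h2⟩
    omega
  rw [Int.natAbs_odd, Zsqrtd.norm_def]
  rw [show β.re * β.re - -1 * β.im * β.im = (β.re + β.im) * (β.re + β.im) - 2 * (β.re * β.im) by
    ring]
  exact (hodd.mul hodd).sub_even (even_two_mul _)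

lemma IsOdd.ne_zero {β : GaussianInt} (hβ : IsOdd β) : β ≠ 0 := by
  rintro rfl
  have := hβ.odd_normExponent
  simp [normExponent] at this

lemma normExponent_nsmul_eq_zero {β : GaussianInt} {δ : ℂ} (h : β.toComplex * δ ∈ lattice) :
    normExponent β • uniformization δ = 0 := by
  have h1 : (β.norm : ℂ) * δ ∈ lattice := by
    have h2 := mul_mem_lattice (α := star β) h
    rwa [← mul_assoc, ← map_mul, mul_comm, mul_comm (star β), ← Zsqrtd.norm_eq_mul_conj,
      map_intCast, mul_comm] at h2
  rw [← zsmul_eq_mul, ← uniformization_eq_zero_iff, map_zsmul] at h1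
  rcases Int.natAbs_eq β.norm with e | e
  · rw [e, natCast_zsmul] at h1
    exact h1
  · rw [e, neg_smul, natCast_zsmul, neg_eq_zero] at h1
    exact h1

lemma phi_eq_iff {β : GaussianInt} (hβ : IsOdd β) {δ ε : ℂ} (hδ : β.toComplex * δ ∈ lattice)
    (hε : β.toComplex * ε ∈ lattice) : phi δ = phi ε ↔ δ - ε ∈ lattice := by
  have h1 := normExponent_nsmul_eq_zero hδ
  have h2 := normExponent_nsmul_eq_zero hε
  have hn := hβ.odd_normExponent
  rw [phi_eq_quarticX hn h1, phi_eq_quarticX hn h2, ← uniformization_eq_iff]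
  exact ⟨eq_of_quarticX_eq hn h1 h2, congrArg _⟩

/-- The torsion point at which the division field is generated. -/
noncomputable abbrev baseTorsion (β : GaussianInt) : ℂ := 2 * (varpi : ℂ) / β.toComplex

lemma mul_baseTorsion_mem {β : GaussianInt} (hβ : IsOdd β) :
    β.toComplex * baseTorsion β ∈ lattice := by
  have h0 : β.toComplex ≠ 0 := by simpa using hβ.ne_zero
  rw [mul_div_cancel₀ _ h0, mem_lattice_iff]
  exact ⟨2, 0, by decide, by push_cast; ring⟩

lemma exists_sub_mul_baseTorsion_mem {β : GaussianInt} (hβ : IsOdd β) {w : ℂ}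
    (hw : β.toComplex * w ∈ lattice) :
    ∃ γ : GaussianInt, w - γ.toComplex * baseTorsion β ∈ lattice := by
  have h0 : β.toComplex ≠ 0 := by simpa using hβ.ne_zero
  obtain ⟨a, b, hab⟩ := hβ
  obtain ⟨c, hc⟩ := mem_lattice_iff_exists_gaussian.1 hw
  have hab' := congrArg GaussianInt.toComplex hab
  simp only [map_add, map_mul, map_one, GaussianInt.toComplex_def' 1 1] at hab'
  -- As `2i = (1 + i)²`, one has `cbi · 2ϖ = (1 + i)ϖc · b(1 + i) = (1 + i)ϖc · (1 - aβ)`, and `(1 +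
  -- i)ϖc = βw`.
  refine ⟨c * b * ⟨0, 1⟩, mem_lattice_iff_exists_gaussian.2 ⟨c * a, ?_⟩⟩
  simp only [map_mul, GaussianInt.toComplex_def' 0 1]
  push_cast at hab' ⊢
  apply mul_left_cancel₀ h0
  rw [mul_sub, hc]
  field_simp
  linear_combination (-(varpi : ℂ) * c.toComplex * (1 + I)) * hab' +
    (varpi : ℂ) * c.toComplex * b.toComplex * I_sq

/-- Membership amounts to `β ∣ (1 - i)α`, and `1 - i`, an associate of `1 + i`, is prime to `β`. -/
lemma mul_baseTorsion_mem_iff {β : GaussianInt} (hβ : IsOdd β) {α : GaussianInt} :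
    α.toComplex * baseTorsion β ∈ lattice ↔ β ∣ α := by
  have h0 : β.toComplex ≠ 0 := by simpa using hβ.ne_zero
  constructor
  · intro h
    obtain ⟨c, hc⟩ := mem_lattice_iff_exists_gaussian.1 h
    obtain ⟨a, b, hab⟩ := hβ
    have hab' := congrArg GaussianInt.toComplex hab
    simp only [map_add, map_mul, map_one, GaussianInt.toComplex_def' 1 1] at hab'
    refine ⟨α * a + c * b * ⟨0, 1⟩, ?_⟩
    apply GaussianInt.toComplex_injective
    simp only [map_add, map_mul, GaussianInt.toComplex_def' 0 1]
    push_cast at hab' ⊢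
    have hv : (varpi : ℂ) ≠ 0 := by exact_mod_cast varpi_pos.ne'
    have hc' : 2 * α.toComplex = (1 + I) * c.toComplex * β.toComplex := by
      apply mul_left_cancel₀ hv
      rw [mul_div_assoc', div_eq_iff h0] at hc
      linear_combination hc
    have h2 : (1 - I) * α.toComplex = c.toComplex * β.toComplex := by
      apply mul_left_cancel₀ (two_ne_zero (α := ℂ))
      linear_combination (1 - I) * hc' - c.toComplex * β.toComplex * I_sq
    linear_combination (-α.toComplex) * hab' + b.toComplex * I * h2 + α.toComplex * b.toComplex * I_sq
  · rintro ⟨c, rfl⟩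
    rw [mul_comm β, map_mul, mul_assoc]
    exact mul_mem_lattice (mul_baseTorsion_mem hβ)

/-- Every such point is an integral combination of the images of `ϖ/n` and `iϖ/n`, which have finite
order. -/
lemma finite_torsion {n : ℕ} (hn : Odd n) : {P : CurvePoint ℂ | n • P = 0}.Finite := by
  have hn0 : (n : ℂ) ≠ 0 := by
    have := hn.pos
    exact_mod_cast this.ne'
  set w : ℂ := varpi / n with hw
  have hnw : (n : ℂ) * w = varpi := by rw [hw]; field_simp
  have h2 : (2 * n : ℕ) • uniformization w = 0 := by
    rw [← map_nsmul, uniformization_eq_zero_iff, mem_lattice_iff]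
    refine ⟨2, 0, by decide, ?_⟩
    rw [nsmul_eq_mul]
    push_cast
    linear_combination 2 * hnw
  have hfin : IsOfFinAddOrder (uniformization w) :=
    isOfFinAddOrder_iff_nsmul_eq_zero.2 ⟨2 * n, Nat.mul_pos two_pos hn.pos, h2⟩
  have hfin' : IsOfFinAddOrder (rotateI (uniformization w)) := rotateI.isOfFinAddOrder hfin
  refine (Set.Finite.image2 (· + ·) (finite_zmultiples.2 hfin)
    (finite_zmultiples.2 hfin')).subset ?_
  intro P hP
  obtain ⟨z, rfl⟩ := exists_uniformization_eq hn hP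
  have hz : (n : ℂ) * z ∈ lattice := by
    rw [← uniformization_eq_zero_iff, ← nsmul_eq_mul, map_nsmul]; exact hP
  obtain ⟨a, b, -, hab⟩ := mem_lattice_iff.1 hz
  refine ⟨a • uniformization w, ⟨a, rfl⟩, b • rotateI (uniformization w), ⟨b, rfl⟩, ?_⟩
  simp only
  rw [← map_zsmul, ← map_zsmul rotateI, ← map_zsmul, ← uniformization_I_mul, ← map_add]
  congr 1
  apply mul_left_cancel₀ hn0
  rw [hab, zsmul_eq_mul, zsmul_eq_mul]
  linear_combination ((a : ℂ) + b * I) * hnw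

-- The substitution `u ↦ u + m` embeds `k(u)` in `L`, and it extends to algebraic elements because
-- `L` is algebraically closed.
open IntermediateField in
lemma exists_algHom_add_natCast {k L : Type*} [Field k] [Field L] [IsAlgClosed L] [Algebra k L]
    {u : L} (hu : Transcendental k u) (m : ℕ) :
    ∃ f : algebraicClosure k⟮u⟯ L →ₐ[k] L,
      f (algebraMap k⟮u⟯ _ (AdjoinSimple.gen k u)) = u + m := by
  have hu' : Transcendental k (u + m) := by
    intro h
    apply hu
    have := h.sub (isAlgebraic_algebraMap (R := k) (A := L) (m : k))
    simpa using this
  let g : k⟮u⟯ →ₐ[k] L := (k⟮u + m⟯.val.comp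
    (RatFunc.algEquivOfTranscendental _ hu').toAlgHom).comp
    (RatFunc.algEquivOfTranscendental _ hu).symm.toAlgHom
  obtain ⟨f, hf⟩ := IsAlgClosed.surjective_domRestrict_of_isAlgebraic (K := k) (L := k⟮u⟯) (M := L)
    (E := algebraicClosure k⟮u⟯ L) g
  refine ⟨f, ?_⟩
  have := DFunLike.congr_fun hf (AdjoinSimple.gen k u)
  refine this.trans ?_
  simp [g]

-- Were `u` transcendental, the embeddings `u ↦ u + m` would carry one torsion point to infinitely
-- many points of the same odd torsion, against `finite_torsion`.
open IntermediateField Classical in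
lemma isAlgebraic_of_torsion {k : Type*} [Field k] [Algebra k ℂ] {n : ℕ} (hn : Odd n) {u v : ℂ}
    (h : v ^ 2 = u ^ 3 + 4 * u) (hP : n • mkPoint u v h = 0) :
    IsAlgebraic k u ∧ IsAlgebraic k v := by
  have hu : IsAlgebraic k u := by
    by_contra hu
    set M := algebraicClosure k⟮u⟯ ℂ
    let u' : M := algebraMap k⟮u⟯ M (AdjoinSimple.gen k u)
    have hu' : (u' : ℂ) = u := rfl
    have hv : v ∈ M := by
      refine mem_algebraicClosure_iff.2 (IsAlgebraic.of_pow two_pos ?_)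
      rw [h, ← hu']
      have : IsAlgebraic k⟮u⟯ (u' : ℂ) := mem_algebraicClosure_iff.1 u'.2
      exact (this.pow 3).add ((isAlgebraic_natCast 4).mul this)
    have h' : (⟨v, hv⟩ : M) ^ 2 = u' ^ 3 + 4 * u' := Subtype.ext h
    have hP' : n • mkPoint u' ⟨v, hv⟩ h' = 0 := by
      apply mapPoint_injective (algebraMap M ℂ)
      rw [map_nsmul, map_zero, mapPoint_mkPoint]
      exact hP
    choose f hf using fun m : ℕ => exists_algHom_add_natCast hu m
    have hinj : Function.Injective fun m : ℕ =>
        mapPoint (f m : M →+* ℂ) (mkPoint u' ⟨v, hv⟩ h') := by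
      intro m m' e
      simp only [mapPoint_mkPoint] at e
      have e1 := (WeierstrassCurve.Affine.Point.some.inj e).1
      have e2 : u + m = u + m' := by rw [← hf m, ← hf m']; exact e1
      exact_mod_cast add_left_cancel e2
    refine Set.infinite_range_of_injective hinj ((finite_torsion hn).subset ?_)
    rintro _ ⟨m, rfl⟩
    simp only [Set.mem_ofPred_eq]
    rw [← map_nsmul, hP', map_zero]
  refine ⟨hu, IsAlgebraic.of_pow two_pos ?_⟩
  rw [h]
  exact (hu.pow 3).add ((isAlgebraic_natCast 4).mul hu)

end Lemniscate

namespace Lemniscate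

/-! ### Embeddings act on torsion values by multipliers; `K_β` is Galois. -/

open Complex

/-- The element `i` of `ℚ(i)`. -/
noncomputable def kI : K := ⟨I, IntermediateField.mem_adjoin_simple_self ℚ I⟩

-- Let `P` over `Ω` lie above the point of `2ϖ/β` through `ι`. Both maps fix `i`, so `h(P)` is again
-- killed by `β` and is `α` times that point. For `δ ≡ γ · 2ϖ/β`, the element `2u/v` at `γP` has
-- image `φ(δ)` under `ι` and, since `γα = αγ`, image `φ(αδ)` under `h`.
open Classical in
lemma exists_gaussian_of_algHom {β : GaussianInt} (hβ : IsOdd β) {Ω : Type*} [Field Ω]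
    [Algebra K Ω] (ι h : Ω →ₐ[K] ℂ)
    (hΩ : ∃ P : CurvePoint Ω, mapPoint (ι : Ω →+* ℂ) P = uniformization (baseTorsion β)) :
    ∃ α : GaussianInt, ∀ δ, β.toComplex * δ ∈ lattice →
      ∃ y : Ω, ι y = phi δ ∧ h y = phi (α.toComplex * δ) := by
  have : CharZero Ω := charZero_of_injective_algebraMap (algebraMap K Ω).injective
  obtain ⟨P, hP⟩ := hΩ
  have hn := hβ.odd_normExponent
  have hi : (algebraMap K Ω kI) ^ 2 = -1 := by
    have : kI ^ 2 = -1 := Subtype.ext I_sq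
    rw [← map_pow, this, map_neg, map_one]
  have hι : (ι : Ω →+* ℂ) (algebraMap K Ω kI) = I := ι.commutes kI
  have hh : (h : Ω →+* ℂ) (algebraMap K Ω kI) = I := h.commutes kI
  have gι : ∀ γ R, mapPoint (ι : Ω →+* ℂ) (gaussMul _ hi γ R) =
      gaussMul I I_sq γ (mapPoint (ι : Ω →+* ℂ) R) := fun γ R => by
    rw [mapPoint_gaussMul _ hi (by rw [hι, I_sq])]; simp only [hι]
  have gh : ∀ γ R, mapPoint (h : Ω →+* ℂ) (gaussMul _ hi γ R) =
      gaussMul I I_sq γ (mapPoint (h : Ω →+* ℂ) R) := fun γ R => by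
    rw [mapPoint_gaussMul _ hi (by rw [hh, I_sq])]; simp only [hh]
  have hPn : normExponent β • P = 0 := by
    apply mapPoint_injective (ι : Ω →+* ℂ)
    rw [map_nsmul, hP, map_zero, normExponent_nsmul_eq_zero (mul_baseTorsion_mem hβ)]
  have hPβ : gaussMul _ hi β P = 0 := by
    apply mapPoint_injective (ι : Ω →+* ℂ)
    rw [gι, hP, map_zero, ← uniformization_gauss_mul,
      uniformization_eq_zero_iff.2 (mul_baseTorsion_mem hβ)]
  obtain ⟨z, hz⟩ := exists_uniformization_eq hn (P := mapPoint (h : Ω →+* ℂ) P)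
    (by rw [← map_nsmul, hPn, map_zero])
  have hzβ : β.toComplex * z ∈ lattice := by
    rw [← uniformization_eq_zero_iff, uniformization_gauss_mul, hz, ← gh, hPβ, map_zero]
  obtain ⟨α, hα⟩ := exists_sub_mul_baseTorsion_mem hβ hzβ
  refine ⟨α, fun δ hδ => ?_⟩
  obtain ⟨γ, hγ⟩ := exists_sub_mul_baseTorsion_mem hβ hδ
  have hαδ : β.toComplex * (α.toComplex * δ) ∈ lattice := by
    rw [mul_left_comm]; exact mul_mem_lattice hδ
  refine ⟨quarticX (gaussMul _ hi γ P), ?_, ?_⟩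
  · have e : ι (quarticX (gaussMul _ hi γ P)) =
        quarticX (mapPoint (ι : Ω →+* ℂ) (gaussMul _ hi γ P)) := (mapPoint_quarticX _ _).symm
    rw [e, gι, hP, ← uniformization_gauss_mul,
      phi_eq_quarticX hn (normExponent_nsmul_eq_zero hδ), uniformization_eq_iff.2 hγ]
  · have e : h (quarticX (gaussMul _ hi γ P)) =
        quarticX (mapPoint (h : Ω →+* ℂ) (gaussMul _ hi γ P)) := (mapPoint_quarticX _ _).symm
    rw [e, gh, ← hz, ← uniformization_gauss_mul,
      phi_eq_quarticX hn (normExponent_nsmul_eq_zero hαδ)]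
    congr 1
    rw [uniformization_eq_iff]
    have := lattice.sub_mem (mul_mem_lattice (α := γ) hα) (mul_mem_lattice (α := α) hγ)
    convert this using 1
    ring

section DivisionField

open IntermediateField

variable {β : GaussianInt}

open Classical in
lemma exists_mapPoint_eq {k : Type*} [Field k] [Algebra k ℂ] {P : CurvePoint ℂ} {n : ℕ}
    (hn : Odd n) (hP : n • P = 0) :
    ∃ Q : CurvePoint (algebraicClosure k ℂ), mapPoint (algebraMap (algebraicClosure k ℂ) ℂ) Q = P := by
  rcases eq_zero_or_eq_mkPoint P with rfl | ⟨u, v, h, rfl⟩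
  · exact ⟨0, map_zero _⟩
  · obtain ⟨hu, hv⟩ := isAlgebraic_of_torsion (k := k) hn h hP
    let u' : algebraicClosure k ℂ := ⟨u, mem_algebraicClosure_iff.2 hu⟩
    let v' : algebraicClosure k ℂ := ⟨v, mem_algebraicClosure_iff.2 hv⟩
    have h' : v' ^ 2 = u' ^ 3 + 4 * u' := Subtype.ext h
    exact ⟨mkPoint u' v' h', rfl⟩

/-- The generator `φ(2ϖ/β)` of the division field. -/
noncomputable def generator (β : GaussianInt) : KBeta β :=
  AdjoinSimple.gen K (phi (baseTorsion β))

lemma isAlgebraic_phi_baseTorsion (hβ : IsOdd β) : IsAlgebraic K (phi (baseTorsion β)) := by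
  have hn := hβ.odd_normExponent
  have h0 := normExponent_nsmul_eq_zero (mul_baseTorsion_mem hβ)
  rw [phi_eq_quarticX hn h0]
  rcases eq_zero_or_eq_mkPoint (uniformization (baseTorsion β)) with e | ⟨u, v, h, e⟩
  · rw [e, quarticX_zero]; exact isAlgebraic_zero
  · rw [e] at h0 ⊢
    obtain ⟨hu, hv⟩ := isAlgebraic_of_torsion (k := K) hn h h0
    rw [quarticX_mkPoint, div_eq_mul_inv]
    exact ((isAlgebraic_natCast 2).mul hu).mul hv.inv

/-- Every embedding of the algebraic closure acts on the `β`-torsion values of `φ` through a single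
multiplier. -/
lemma exists_gaussian_of_closure (hβ : IsOdd β)
    (h : algebraicClosure (KBeta β) ℂ →ₐ[K] ℂ) :
    ∃ α : GaussianInt, ∀ δ, β.toComplex * δ ∈ lattice →
      ∃ y : algebraicClosure (KBeta β) ℂ, (y : ℂ) = phi δ ∧ h y = phi (α.toComplex * δ) :=
  exists_gaussian_of_algHom hβ
    ((algebraicClosure (KBeta β) ℂ).val.restrictScalars K) h
    (exists_mapPoint_eq (k := KBeta β) hβ.odd_normExponent
      (normExponent_nsmul_eq_zero (mul_baseTorsion_mem hβ)))

/-- An automorphism of the algebraic closure over `K_β` fixes `φ(2ϖ/β)`, so its multiplier fixes the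
class of `2ϖ/β` and hence all `β`-torsion. Thus `φ(δ)` is fixed by the whole Galois group. -/
lemma phi_mem_KBeta (hβ : IsOdd β) {δ : ℂ} (hδ : β.toComplex * δ ∈ lattice) :
    phi δ ∈ KBeta β := by
  set Ω := algebraicClosure (KBeta β) ℂ
  have : Normal (KBeta β) Ω := IsAlgClosure.normal _ _
  have : IsGalois (KBeta β) Ω := {}
  obtain ⟨_, hα₀⟩ := exists_gaussian_of_closure hβ (Ω.val.restrictScalars K)
  obtain ⟨y, hy, -⟩ := hα₀ δ hδ
  have hbot : y ∈ (⊥ : IntermediateField (KBeta β) Ω) := by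
    rw [InfiniteGalois.mem_bot_iff_fixed]
    intro g
    obtain ⟨α, hα⟩ := exists_gaussian_of_closure hβ ((Ω.val.comp g.toAlgHom).restrictScalars K)
    obtain ⟨x, hx, hx'⟩ := hα _ (mul_baseTorsion_mem hβ)
    obtain ⟨y', hy', hy''⟩ := hα δ hδ
    obtain rfl : y' = y := Subtype.ext (hy'.trans hy.symm)
    have hxg : x = algebraMap (KBeta β) Ω (generator β) := Subtype.ext hx
    have hgx : g x = x := by rw [hxg, AlgEquiv.commutes]
    have e1 : phi (baseTorsion β) = phi (α.toComplex * baseTorsion β) := by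
      rw [← hx, ← hx']; exact congrArg Subtype.val hgx.symm
    rw [phi_eq_iff hβ (mul_baseTorsion_mem hβ)
      (by rw [mul_left_comm]; exact mul_mem_lattice (mul_baseTorsion_mem hβ))] at e1
    obtain ⟨γ, hγ⟩ := exists_sub_mul_baseTorsion_mem hβ hδ
    have e2 : δ - α.toComplex * δ ∈ lattice := by
      have := lattice.add_mem (lattice.sub_mem hγ (mul_mem_lattice (α := α) hγ))
        (mul_mem_lattice (α := γ) e1)
      convert this using 1
      ring
    rw [← phi_eq_iff hβ hδ (by rw [mul_left_comm]; exact mul_mem_lattice hδ)] at e2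
    apply Subtype.ext
    rw [hy', e2]
    exact hy''
  obtain ⟨x, hx⟩ := mem_bot.1 hbot
  rw [← hy, ← hx]
  exact x.2

lemma exists_gaussian_of_embedding (hβ : IsOdd β) (f : KBeta β →ₐ[K] ℂ) :
    ∃ α : GaussianInt, ∀ δ (hδ : β.toComplex * δ ∈ lattice),
      f ⟨phi δ, phi_mem_KBeta hβ hδ⟩ = phi (α.toComplex * δ) := by
  obtain ⟨h, hh⟩ := IsAlgClosed.surjective_domRestrict_of_isAlgebraic (K := K) (L := KBeta β)
    (M := ℂ) (E := algebraicClosure (KBeta β) ℂ) f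
  obtain ⟨α, hα⟩ := exists_gaussian_of_closure hβ h
  refine ⟨α, fun δ hδ => ?_⟩
  obtain ⟨y, hy, hy'⟩ := hα δ hδ
  rw [← hy', ← hh]
  exact congrArg h (Subtype.ext hy.symm)

/-- Each conjugate of `φ(2ϖ/β)` is some `φ(α · 2ϖ/β)`, already in `K_β`, so `K_β` is the splitting
field of its minimal polynomial. -/
lemma isGalois_KBeta (hβ : IsOdd β) : IsGalois K (KBeta β) := by
  have hint := (isAlgebraic_phi_baseTorsion hβ).isIntegral
  set p := minpoly K (phi (baseTorsion β))
  have hsplit : (p.map (algebraMap K ℂ)).Splits := IsAlgClosed.splits _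
  have hadj : adjoin K (p.rootSet ℂ) = KBeta β := by
    apply le_antisymm
    · rw [adjoin_le_iff]
      intro r hr
      obtain ⟨α, hα⟩ := exists_gaussian_of_embedding hβ
        ((algHomAdjoinIntegralEquiv K hint).symm ⟨r, (Polynomial.mem_rootSet'.1 hr |> fun h =>
          (Polynomial.mem_aroots'.2 h))⟩)
      have := hα _ (mul_baseTorsion_mem hβ)
      have e := algHomAdjoinIntegralEquiv_symm_apply_gen K hint (K := ℂ) ⟨r,
        (Polynomial.mem_rootSet'.1 hr |> fun h => (Polynomial.mem_aroots'.2 h))⟩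
      have e' : r = phi (α.toComplex * baseTorsion β) := e.symm.trans this
      rw [e']
      exact phi_mem_KBeta hβ (by rw [mul_left_comm]; exact mul_mem_lattice (mul_baseTorsion_mem hβ))
    · rw [adjoin_simple_le_iff]
      exact subset_adjoin _ _ (Polynomial.mem_rootSet'.2
        ⟨Polynomial.map_ne_zero (minpoly.ne_zero hint), minpoly.aeval _ _⟩)
  have hsf : p.IsSplittingField K (adjoin K (p.rootSet ℂ)) := adjoin_rootSet_isSplittingField hsplit
  rw [hadj] at hsf
  have : Normal K (KBeta β) := Normal.of_isSplittingField p
  exact {}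

end DivisionField

end Lemniscate

namespace Lemniscate

/-! ### The homomorphism to the units of the residue ring. -/

section Action

open IntermediateField

variable {β : GaussianInt}

lemma mul_mul_mem_lattice (α : GaussianInt) {δ : ℂ} (hδ : β.toComplex * δ ∈ lattice) :
    β.toComplex * (α.toComplex * δ) ∈ lattice := by
  rw [mul_left_comm]; exact mul_mem_lattice hδ

lemma isTorsionGenerator_baseTorsion (hβ : IsOdd β) : IsTorsionGenerator β (baseTorsion β) :=
  ⟨mul_baseTorsion_mem hβ, fun _ hw => exists_sub_mul_baseTorsion_mem hβ hw⟩

lemma phi_mul_baseTorsion_eq_iff (hβ : IsOdd β) {α γ : GaussianInt} :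
    phi (α.toComplex * baseTorsion β) = phi (γ.toComplex * baseTorsion β) ↔
      Ideal.Quotient.mk (Ideal.span {β}) α = Ideal.Quotient.mk (Ideal.span {β}) γ := by
  rw [phi_eq_iff hβ (mul_mul_mem_lattice α (mul_baseTorsion_mem hβ))
    (mul_mul_mem_lattice γ (mul_baseTorsion_mem hβ)), ← sub_mul, ← map_sub,
    mul_baseTorsion_mem_iff hβ, Ideal.Quotient.eq, Ideal.mem_span_singleton]

lemma phi_mul_eq_of_mk_eq (hβ : IsOdd β) {α γ : GaussianInt}
    (h : Ideal.Quotient.mk (Ideal.span {β}) α = Ideal.Quotient.mk (Ideal.span {β}) γ) {δ : ℂ}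
    (hδ : β.toComplex * δ ∈ lattice) : phi (α.toComplex * δ) = phi (γ.toComplex * δ) := by
  rw [phi_eq_iff hβ (mul_mul_mem_lattice α hδ) (mul_mul_mem_lattice γ hδ), ← sub_mul, ← map_sub]
  rw [Ideal.Quotient.eq, Ideal.mem_span_singleton] at h
  obtain ⟨c, hc⟩ := h
  rw [hc, mul_comm β, map_mul, mul_assoc]
  exact mul_mem_lattice hδ

lemma exists_gaussian_of_algEquiv (hβ : IsOdd β) (σ : KBeta β ≃ₐ[K] KBeta β) :
    ∃ α : GaussianInt, ∀ δ (hδ : β.toComplex * δ ∈ lattice),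
      σ ⟨phi δ, phi_mem_KBeta hβ hδ⟩ =
        ⟨phi (α.toComplex * δ), phi_mem_KBeta hβ (mul_mul_mem_lattice α hδ)⟩ := by
  obtain ⟨α, hα⟩ := exists_gaussian_of_embedding hβ ((KBeta β).val.comp σ.toAlgHom)
  exact ⟨α, fun δ hδ => Subtype.ext (hα δ hδ)⟩

/-- The multiplier of `σ⁻¹` inverts that of `σ` modulo `β`, as their product fixes `φ(2ϖ/β)`. -/
lemma exists_actsThrough (hβ : IsOdd β) (σ : KBeta β ≃ₐ[K] KBeta β) :
    ∃ u : (ResidueRing β)ˣ, ActsThrough β σ u := by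
  obtain ⟨α, hα⟩ := exists_gaussian_of_algEquiv hβ σ
  obtain ⟨α', hα'⟩ := exists_gaussian_of_algEquiv hβ σ.symm
  have hb := mul_baseTorsion_mem hβ
  have hinv : Ideal.Quotient.mk (Ideal.span {β}) (α' * α) =
      Ideal.Quotient.mk (Ideal.span {β}) 1 := by
    rw [← phi_mul_baseTorsion_eq_iff hβ, map_mul, mul_assoc, map_one, one_mul]
    have h := hα' _ (mul_mul_mem_lattice α hb)
    rw [← hα _ hb, AlgEquiv.symm_apply_apply] at h
    exact (congrArg Subtype.val h).symm
  rw [map_mul, map_one] at hinv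
  refine ⟨⟨Ideal.Quotient.mk _ α, Ideal.Quotient.mk _ α', by rw [mul_comm, hinv], hinv⟩,
    fun δ hδ => ⟨phi_mem_KBeta hβ hδ.1, fun γ hγ => ?_⟩⟩
  rw [hα δ hδ.1]
  exact (phi_mul_eq_of_mk_eq hβ hγ hδ.1).symm

lemma ActsThrough.unique (hβ : IsOdd β) {σ : KBeta β ≃ₐ[K] KBeta β} {u v : (ResidueRing β)ˣ}
    (hu : ActsThrough β σ u) (hv : ActsThrough β σ v) : u = v := by
  obtain ⟨α, hα⟩ := Ideal.Quotient.mk_surjective (u : ResidueRing β)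
  obtain ⟨γ, hγ⟩ := Ideal.Quotient.mk_surjective (v : ResidueRing β)
  obtain ⟨_, h1⟩ := hu _ (isTorsionGenerator_baseTorsion hβ)
  obtain ⟨_, h2⟩ := hv _ (isTorsionGenerator_baseTorsion hβ)
  apply Units.ext
  rw [← hα, ← hγ, ← phi_mul_baseTorsion_eq_iff hβ]
  exact (h1 α hα).symm.trans (h2 γ hγ)

/-- Needed for composition: `ActsThrough` speaks only of generators, so the image of one under a
unit must again be one. -/
lemma IsTorsionGenerator.mul {δ : ℂ} (hδ : IsTorsionGenerator β δ) {α γ : GaussianInt}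
    (h : Ideal.Quotient.mk (Ideal.span {β}) (γ * α) = 1) :
    IsTorsionGenerator β (α.toComplex * δ) := by
  refine ⟨mul_mul_mem_lattice α hδ.1, fun w hw => ?_⟩
  obtain ⟨ε, hε⟩ := hδ.2 w hw
  rw [← map_one (Ideal.Quotient.mk (Ideal.span {β})), Ideal.Quotient.eq,
    Ideal.mem_span_singleton] at h
  obtain ⟨c, hc⟩ := h
  refine ⟨ε * γ, ?_⟩
  have h1 : (ε * c).toComplex * (β.toComplex * δ) ∈ lattice := mul_mem_lattice hδ.1
  have hc' := congrArg GaussianInt.toComplex hc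
  simp only [map_sub, map_mul, map_one] at hc' h1 ⊢
  have := lattice.sub_mem hε h1
  convert this using 1
  linear_combination (-(ε.toComplex * δ)) * hc'

lemma ActsThrough.mul {σ τ : KBeta β ≃ₐ[K] KBeta β} {u v : (ResidueRing β)ˣ}
    (hβ : IsOdd β) (hu : ActsThrough β σ u) (hv : ActsThrough β τ v) :
    ActsThrough β (σ * τ) (u * v) := by
  intro δ hδ
  obtain ⟨α, hα⟩ := Ideal.Quotient.mk_surjective (u : ResidueRing β)
  obtain ⟨γ, hγ⟩ := Ideal.Quotient.mk_surjective (v : ResidueRing β)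
  obtain ⟨γ', hγ'⟩ := Ideal.Quotient.mk_surjective ((v⁻¹ : (ResidueRing β)ˣ) : ResidueRing β)
  have hδ' : IsTorsionGenerator β (γ.toComplex * δ) :=
    hδ.mul (γ := γ') (by rw [map_mul, hγ, hγ', Units.inv_mul])
  obtain ⟨h1, h1'⟩ := hv δ hδ
  obtain ⟨h2, h2'⟩ := hu _ hδ'
  refine ⟨h1, fun ε hε => ?_⟩
  have e : τ ⟨phi δ, h1⟩ = ⟨phi (γ.toComplex * δ), h2⟩ := Subtype.ext (h1' γ hγ)
  rw [AlgEquiv.mul_apply, e, h2' α hα, ← mul_assoc, ← map_mul]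
  refine phi_mul_eq_of_mk_eq hβ ?_ hδ.1
  rw [map_mul, hα, hγ, hε, Units.val_mul]

/-- The class fixes the image of `φ(2ϖ/β)`, which generates `K_β`; this gives injectivity. -/
lemma ActsThrough.algEquiv_eq (hβ : IsOdd β) {σ τ : KBeta β ≃ₐ[K] KBeta β}
    {u : (ResidueRing β)ˣ} (hσ : ActsThrough β σ u) (hτ : ActsThrough β τ u) : σ = τ := by
  obtain ⟨α, hα⟩ := Ideal.Quotient.mk_surjective (u : ResidueRing β)
  obtain ⟨_, h1⟩ := hσ _ (isTorsionGenerator_baseTorsion hβ)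
  obtain ⟨_, h2⟩ := hτ _ (isTorsionGenerator_baseTorsion hβ)
  have hgen : σ (generator β) = τ (generator β) :=
    Subtype.ext ((h1 α hα).trans (h2 α hα).symm)
  have : (σ : KBeta β →ₐ[K] KBeta β) = τ := by
    refine adjoin_algHom_ext K fun x hx => ?_
    obtain rfl := Set.mem_singleton_iff.1 hx
    exact hgen
  exact AlgEquiv.ext fun x => DFunLike.congr_fun this x

end Action

end Lemniscate

theorem proposition3p2 (β : GaussianInt) (hβ : Lemniscate.IsOdd β) :
    IsGalois Lemniscate.K (Lemniscate.KBeta β) ∧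
    (∀ σ : Lemniscate.KBeta β ≃ₐ[Lemniscate.K] Lemniscate.KBeta β,
      ∃! u : (Lemniscate.ResidueRing β)ˣ, Lemniscate.ActsThrough β σ u) ∧
    ∃ ρ : (Lemniscate.KBeta β ≃ₐ[Lemniscate.K] Lemniscate.KBeta β) →*
        (Lemniscate.ResidueRing β)ˣ,
      (∀ σ, Lemniscate.ActsThrough β σ (ρ σ)) ∧ Function.Injective ρ := by
  refine ⟨Lemniscate.isGalois_KBeta hβ, fun σ => ?_, ?_⟩
  · obtain ⟨u, hu⟩ := Lemniscate.exists_actsThrough hβ σ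
    exact ⟨u, hu, fun v hv => hv.unique hβ hu⟩
  · choose ρ hρ using Lemniscate.exists_actsThrough hβ
    refine ⟨MonoidHom.mk' ρ fun σ τ => (hρ (σ * τ)).unique hβ ((hρ σ).mul hβ (hρ τ)), hρ, ?_⟩
    intro σ τ h
    have h' : ρ σ = ρ τ := h
    exact (hρ σ).algEquiv_eq hβ (h' ▸ hρ τ)
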